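/- Let $d\ge 0$ be an integer with $d\neq 2$, let $a>1$ and $A\in\mathbb R$. There exist constants $c_1>1$ and $c_2>0$, depending only on $a$, $A$ and $d$, such that the following holds. Let $\|\cdot\|$ be any norm on $\mathbb R^d$, let $\mathcal Z\subset\mathbb R^d$ be a Borel set, and for probability distributions $Q_1,Q_2$ on $\mathcal Z$ let $$D_{W_1}(Q_1,Q_2)=\inf_{\Pi}\int_{\mathcal Z^2}\|z_1-z_2\|\,\Pi(\mathrm dz_1,\mathrm dz_2)\in[0,\infty],$$ where the infimum is over all joint distributions $\Pi$ with marginals $Q_1$ and $Q_2$. Let $P_{\text{train}}$ and $P_{\text{test}}$ be probability distributions on $\mathcal Z$ such that $$\mathbb E_{P_{\text{train}}}[\exp(\|z\|^a)]=A<\infty\qquad\text{and}\qquad D_{W_1}(P_{\text{train}},P_{\text{test}})<\infty .$$ Let $\mathcal F$ be a set, let $\ell:\mathcal F\times\mathcal Z\to\mathbb R$ be such that $\ell(f,\cdot)$ is measurable for every $f\in\mathcal F$, and let $f^*_{\text{test}}\in\arg\min_{f\in\mathcal F}\mathbb E_{P_{\text{test}}}[\ell(f,z)]$. Let $\delta>0$,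 let $n\ge 1$ be an integer with $n\ge \frac{\log(c_1/\delta)}{c_2}$, let $\hat P_{\text{train}}$ be the empirical distribution of $n$ i.i.d. samples from $P_{\text{train}}$, and set $$\eta=D_{W_1}(P_{\text{train}},P_{\text{test}})+\Big(\frac{\log(c_1/\delta)}{c_2n}\Big)^{1/\max\{d,2\}} .$$ Let $f^*_{\text{W-dro}}$ be a (sample-dependent) solution, almost surely, of the 1-Wasserstein distributionally robust problem $$\min_{f\in\mathcal F}\ \sup_{Q:\,D_{W_1}(Q,\hat P_{\text{train}})\le\eta}\ \mathbb E_Q[\ell(f,z)],$$ where $Q$ ranges over the probability distributions on $\mathcal Z$. Then, with probability at least $1-\delta$, $$\mathbb E_{P_{\text{test}}}[\ell(f^*_{\text{W-dro}},z)]-\mathbb E_{P_{\text{test}}}[\ell(f^*_{\text{test}},z)]\ \le\ 2\,\|\ell(f^*_{\text{test}},\cdot)\|_{\mathrm{Lip}}\,\eta ,$$ where $\|g\|_{\mathrm{Lip}}\in[0,\infty]$ is the smallest Lipschitz constant of $g$ on $\mathcal Z$ with respect to $\|\cdot\|$. Expectations are taken in $[-\infty,\infty]$, with $\mathbb E_Q[g]=+\infty$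 whenever $\mathbb E_Q[g^+]=+\infty$. (For $\delta\ge1$ the claim is void.) -/

import Mathlib

open MeasureTheory ProbabilityTheory
open scoped ENNReal NNReal

noncomputable section

namespace WDRO

/-- The couplings of `P` and `Q`: joint distributions on `Z × Z` with marginals `P` and `Q`. -/
def couplings {Z : Type*} [MeasurableSpace Z] (P Q : Measure Z) : Set (Measure (Z × Z)) :=
  {γ | γ.map Prod.fst = P ∧ γ.map Prod.snd = Q}

/-- The 1-Wasserstein distance `inf_γ ∫ d(x, y) γ(dx, dy)` over all couplings, with values in
`[0, ∞]`. -/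
def W1 {Z : Type*} [MeasurableSpace Z] [PseudoEMetricSpace Z] (P Q : Measure Z) : ℝ≥0∞ :=
  ⨅ γ ∈ couplings P Q, ∫⁻ p, edist p.1 p.2 ∂γ

/-- The expectation `E_P[g] = E_P[g⁺] - E_P[g⁻]` as an extended real number; it is `+∞` as soon as
`E_P[g⁺] = ∞` (in particular in the undefined case `∞ - ∞`, the usual convention in minimization).
It is the ordinary integral whenever `g` is integrable. -/
def expect {Z : Type*} [MeasurableSpace Z] (P : Measure Z) (g : Z → ℝ) : EReal :=
  open Classical in
  if ∫⁻ z, ENNReal.ofReal (g z) ∂P = ∞ then ⊤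
  else ((∫⁻ z, ENNReal.ofReal (g z) ∂P : ℝ≥0∞) : EReal)
    - ((∫⁻ z, ENNReal.ofReal (-g z) ∂P : ℝ≥0∞) : EReal)

/-- The Lipschitz norm: the smallest Lipschitz constant of `g`, and `∞` if there is none. -/
def lipNorm {Z : Type*} [PseudoEMetricSpace Z] (g : Z → ℝ) : ℝ≥0∞ :=
  ⨅ (K : ℝ≥0) (_ : LipschitzWith K g), (K : ℝ≥0∞)

/-- The empirical distribution of the points `x 0, …, x (n - 1)`. -/
def empirical {Z : Type*} [MeasurableSpace Z] {n : ℕ} (x : Fin n → Z) : Measure Z :=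
  (n : ℝ≥0∞)⁻¹ • ∑ i, Measure.dirac (x i)

/-- The ambiguity set: all probability distributions `Q` on `Z` with `W1 Q P ≤ η`. -/
def ball {Z : Type*} [MeasurableSpace Z] [PseudoEMetricSpace Z] (P : Measure Z) (η : ℝ) :
    Set (Measure Z) :=
  {Q | IsProbabilityMeasure Q ∧ W1 Q P ≤ ENNReal.ofReal η}

/-- The worst-case expected loss of `g` over the 1-Wasserstein ball of radius `η` around `P`. -/
def worstCase {Z : Type*} [MeasurableSpace Z] [PseudoEMetricSpace Z] (P : Measure Z) (η : ℝ)
    (g : Z → ℝ) : EReal :=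
  ⨆ Q ∈ ball P η, expect Q g

/-- `f` is an oracle best solution under `P`: it minimizes the expected loss. -/
def IsOracle {Z F : Type*} [MeasurableSpace Z] (ℓ : F → Z → ℝ) (P : Measure Z) (f : F) : Prop :=
  ∀ f' : F, expect P (ℓ f) ≤ expect P (ℓ f')

/-- `f` is a solution of the 1-Wasserstein DRO problem with center `P` and radius `η`. -/
def IsDROSolution {Z F : Type*} [MeasurableSpace Z] [PseudoEMetricSpace Z] (ℓ : F → Z → ℝ)
    (P : Measure Z) (η : ℝ) (f : F) : Prop :=
  ∀ f' : F, worstCase P η (ℓ f) ≤ worstCase P η (ℓ f')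

/-- The ball size `D(Ptrain, Ptest) + (log (c₁ / δ) / (c₂ n)) ^ (1 / max {d, 2})`. -/
def radius {Z : Type*} [MeasurableSpace Z] [PseudoEMetricSpace Z] (Ptrain Ptest : Measure Z)
    (c₁ c₂ δ : ℝ) (n d : ℕ) : ℝ :=
  (W1 Ptrain Ptest).toReal + (Real.log (c₁ / δ) / (c₂ * n)) ^ ((1 : ℝ) / (max d 2 : ℕ))

end WDRO

end

/-! The deterministic half is short. If the empirical measure lies within `ε` of the training law,
the triangle inequality places the test law in the ambiguity ball of radius `η`, so the test loss of
the DRO solution is at most its worst case, hence at most the worst case of the competitor. Every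
law in the ball is within `2η` of the test law, and a Lipschitz loss changes its mean by at most its
Lipschitz constant times the transport distance (`expect_sub_le_of_isDROSolution`).

The probabilistic half is the tail bound `c₁ exp(-c₂ n ε ^ max d 2)` for `ε ≤ 1`, with constants
that do not see the norm (`exists_measure_W1_empirical_gt_le`). It combines two facts.

Mean rate (`exists_lintegral_W1_empirical_le`): mass is transported along the tree of dyadic cells,
and at each scale only the discrepancy of cell masses moves. Variances bound these discrepancies,
and polynomial weights make the sum over the unbounded lattice converge. Scale `j` contributes about
`n ^ (-1/2) (2 ^ (d/2) / 2) ^ j`, a geometric series of ratio different from one exactly when `d ≠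
2`, so cutting at `2 ^ L ≈ n ^ (1 / max d 2)` gives the rate `n ^ (-1 / max d 2)`. Auerbach
coordinates make the cells comparable to balls of an arbitrary norm at the cost of a factor `d`.

Concentration (`measure_W1_empirical_gt_le`): the distance to the empirical measure is
`1/n`-Lipschitz in the sum of the sample displacements. Symmetrization bounds the exponential moment
of a Lipschitz function of one variable, induction extends this to `n` variables, and Chernoff's
bound gives Gaussian tails for deviations up to one.

Where `ε` is below twice the mean bound, the tail estimate is trivial by the choice of `c₁`;
elsewhere the deviation from the mean is at least `ε / 2`. -/

namespace WDRO

/-! ### Empirical measures and couplings. -/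

section Empirical

variable {Z : Type*} [MeasurableSpace Z]

theorem isProbabilityMeasure_empirical {n : ℕ} (hn : 1 ≤ n) (x : Fin n → Z) :
    IsProbabilityMeasure (empirical x) := by
  refine ⟨?_⟩
  simp only [empirical, Measure.smul_apply, Measure.finsetSum_apply, measure_univ,
    Finset.sum_const, Finset.card_univ, Fintype.card_fin, nsmul_eq_mul, mul_one, smul_eq_mul]
  exact ENNReal.inv_mul_cancel (by simp; omega) (by simp)

/-- As images of one measure on the index set, two empirical measures are coupled by matching equal
indices. -/
theorem empirical_eq_map {n : ℕ} (x : Fin n → Z) :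
    empirical x = (((n : ℝ≥0∞)⁻¹) • (Measure.count : Measure (Fin n))).map x := by
  rw [Measure.map_smul, Measure.count, Measure.sum_fintype, empirical]
  rw [Measure.map_finset_sum (measurable_of_countable x).aemeasurable]
  congr 1
  refine Finset.sum_congr rfl fun i _ => ?_
  rw [Measure.map_dirac' (measurable_of_countable x)]

theorem isFiniteMeasure_of_mem_couplings {P Q : Measure Z} [IsFiniteMeasure P]
    {γ : Measure (Z × Z)} (h : γ ∈ couplings P Q) : IsFiniteMeasure γ := by
  refine ⟨?_⟩
  have := congrArg (fun m => m Set.univ) h.1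
  simp only [Measure.map_apply measurable_fst MeasurableSet.univ, Set.preimage_univ] at this
  rw [this]
  exact measure_lt_top P _

end Empirical

/-! ### Basic properties of the Wasserstein distance. -/

section Wasserstein

variable {Z : Type*} [MeasurableSpace Z] [PseudoEMetricSpace Z]

theorem W1_le_of_mem_couplings {P Q : Measure Z} {γ : Measure (Z × Z)} (h : γ ∈ couplings P Q) :
    W1 P Q ≤ ∫⁻ p, edist p.1 p.2 ∂γ :=
  iInf₂_le γ h

theorem le_W1 {P Q : Measure Z} {c : ℝ≥0∞}
    (h : ∀ γ ∈ couplings P Q, c ≤ ∫⁻ p, edist p.1 p.2 ∂γ) : c ≤ W1 P Q :=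
  le_iInf₂ h

theorem exists_coupling_of_W1_lt {P Q : Measure Z} {c : ℝ≥0∞} (h : W1 P Q < c) :
    ∃ γ ∈ couplings P Q, ∫⁻ p, edist p.1 p.2 ∂γ < c := by
  simpa [W1, iInf_lt_iff] using h

variable [OpensMeasurableSpace Z] [SecondCountableTopology Z]

theorem measurable_edist_pair : Measurable (fun p : Z × Z => edist p.1 p.2) :=
  measurable_edist

theorem W1_comm_le (P Q : Measure Z) : W1 P Q ≤ W1 Q P := by
  refine le_W1 fun γ hγ => ?_
  have hmem : γ.map Prod.swap ∈ couplings P Q := by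
    constructor
    · rw [Measure.map_map measurable_fst measurable_swap]; exact hγ.2
    · rw [Measure.map_map measurable_snd measurable_swap]; exact hγ.1
  refine (W1_le_of_mem_couplings hmem).trans (le_of_eq ?_)
  rw [lintegral_map measurable_edist_pair measurable_swap]
  simp [edist_comm]

theorem W1_comm (P Q : Measure Z) : W1 P Q = W1 Q P :=
  le_antisymm (W1_comm_le P Q) (W1_comm_le Q P)

theorem W1_map_map_le {X : Type*} [MeasurableSpace X] (ρ : Measure X) {f g : X → Z}
    (hf : Measurable f) (hg : Measurable g) :
    W1 (ρ.map f) (ρ.map g) ≤ ∫⁻ x, edist (f x) (g x) ∂ρ := by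
  have hmem : ρ.map (fun x => (f x, g x)) ∈ couplings (ρ.map f) (ρ.map g) := by
    constructor
    · rw [Measure.map_map measurable_fst (hf.prodMk hg)]; rfl
    · rw [Measure.map_map measurable_snd (hf.prodMk hg)]; rfl
  refine (W1_le_of_mem_couplings hmem).trans (le_of_eq ?_)
  rw [lintegral_map measurable_edist_pair (hf.prodMk hg)]

theorem W1_self (P : Measure Z) : W1 P P = 0 := by
  have := W1_map_map_le P (f := id) (g := id) measurable_id measurable_id
  simpa using this

omit [OpensMeasurableSpace Z] [SecondCountableTopology Z] in
-- The sum of two couplings is a coupling. Applied with a common summand, this lets shared mass stay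
-- in place for free.
theorem W1_add_le (P P' Q Q' : Measure Z) : W1 (P + P') (Q + Q') ≤ W1 P Q + W1 P' Q' := by
  simp only [W1]
  simp only [ENNReal.iInf_add, ENNReal.add_iInf]
  refine le_iInf₂ fun γ' hγ' => le_iInf₂ fun γ hγ => ?_
  have hmem : γ + γ' ∈ couplings (P + P') (Q + Q') := by
    constructor
    · rw [Measure.map_add _ _ measurable_fst, hγ.1, hγ'.1]
    · rw [Measure.map_add _ _ measurable_snd, hγ.2, hγ'.2]
  refine (iInf₂_le _ hmem).trans (le_of_eq ?_)
  rw [lintegral_add_measure]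

/-- Gluing: the second coupling is disintegrated over its first marginal `Q`, and its conditional
kernel is attached to the second coordinate of the first coupling. -/
theorem W1_triangle [StandardBorelSpace Z] (P Q R : Measure Z) [IsFiniteMeasure Q] :
    W1 P R ≤ W1 P Q + W1 Q R := by
  -- Conditional kernels need a nonempty space; on an empty one all measures coincide.
  rcases isEmpty_or_nonempty Z with hZ | hZ
  · have h : ∀ m : Measure Z, m = P := fun m => by
      ext s _
      simp [Set.eq_empty_of_isEmpty s]
    rw [h R, W1_self]
    exact zero_le
  conv_rhs => simp only [W1]
  simp only [ENNReal.iInf_add, ENNReal.add_iInf]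
  refine le_iInf₂ fun γ₂ h₂ => le_iInf₂ fun γ₁ h₁ => ?_
  have : IsFiniteMeasure γ₂ := isFiniteMeasure_of_mem_couplings h₂
  have : IsFiniteMeasure γ₁ := by
    have hs : γ₁.map Prod.swap ∈ couplings Q P := by
      constructor
      · rw [Measure.map_map measurable_fst measurable_swap]; exact h₁.2
      · rw [Measure.map_map measurable_snd measurable_swap]; exact h₁.1
    have := isFiniteMeasure_of_mem_couplings hs
    exact (Measure.isFiniteMeasure_map_iff measurable_swap.aemeasurable).1 this
  set K := γ₂.condKernel with hK
  have hdis : γ₂.fst ⊗ₘ K = γ₂ := γ₂.disintegrate K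
  set τ : Measure ((Z × Z) × Z) := γ₁ ⊗ₘ (K.comap Prod.snd measurable_snd) with hτ
  have hτ₁ : τ.map Prod.fst = γ₁ := by
    have := Measure.fst_compProd γ₁ (K.comap Prod.snd measurable_snd)
    simpa [Measure.fst] using this
  have hm : Measurable (fun t : (Z × Z) × Z => (t.1.2, t.2)) := by fun_prop
  have hτ₂ : τ.map (fun t => (t.1.2, t.2)) = γ₂ := by
    rw [← hdis]
    refine Measure.ext_of_lintegral _ fun f hf => ?_
    rw [lintegral_map hf hm, hτ, Measure.lintegral_compProd (by fun_prop),
      Measure.lintegral_compProd hf, Measure.fst, h₂.1, ← h₁.2,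
      lintegral_map (by fun_prop) measurable_snd]
    rfl
  have hm' : Measurable (fun t : (Z × Z) × Z => (t.1.1, t.2)) := by fun_prop
  have hmem : τ.map (fun t => (t.1.1, t.2)) ∈ couplings P R := by
    constructor
    · rw [Measure.map_map measurable_fst hm', ← h₁.1, ← hτ₁,
        Measure.map_map measurable_fst measurable_fst]
      rfl
    · rw [Measure.map_map measurable_snd hm', ← h₂.2, ← hτ₂,
        Measure.map_map measurable_snd hm]
      rfl
  refine (W1_le_of_mem_couplings hmem).trans ?_
  rw [lintegral_map measurable_edist_pair hm']
  calc ∫⁻ t, edist t.1.1 t.2 ∂τ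
      ≤ ∫⁻ t, (edist t.1.1 t.1.2 + edist t.1.2 t.2) ∂τ :=
        lintegral_mono fun t => edist_triangle _ _ _
    _ = ∫⁻ t, edist t.1.1 t.1.2 ∂τ + ∫⁻ t, edist t.1.2 t.2 ∂τ :=
        lintegral_add_left (measurable_edist_pair.comp measurable_fst) _
    _ = _ := by
        congr 1
        · rw [← hτ₁, lintegral_map measurable_edist_pair measurable_fst]
        · rw [← hτ₂, lintegral_map measurable_edist_pair hm]

theorem W1_empirical_le {n : ℕ} (x y : Fin n → Z) :
    W1 (empirical x) (empirical y) ≤ (n : ℝ≥0∞)⁻¹ * ∑ i, edist (x i) (y i) := by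
  rw [empirical_eq_map, empirical_eq_map]
  refine (W1_map_map_le _ (measurable_of_countable x) (measurable_of_countable y)).trans ?_
  rw [lintegral_smul_measure, lintegral_count, tsum_fintype, smul_eq_mul]

end Wasserstein

/-! ### The deterministic regret bound. -/

section DRO

theorem expect_eq_integral {Z : Type*} [MeasurableSpace Z] {P : Measure Z} {g : Z → ℝ}
    (hg : Integrable g P) : expect P g = ((∫ z, g z ∂P : ℝ) : EReal) := by
  have h1 : ∫⁻ z, ENNReal.ofReal (g z) ∂P ≠ ∞ := (hg.lintegral_lt_top).ne
  have h2 : ∫⁻ z, ENNReal.ofReal (-g z) ∂P ≠ ∞ := (hg.neg.lintegral_lt_top).ne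
  rw [expect, if_neg h1, integral_eq_lintegral_pos_part_sub_lintegral_neg_part hg,
    EReal.coe_sub, EReal.coe_ennreal_toReal h1, EReal.coe_ennreal_toReal h2]

variable {Z : Type*} [MeasurableSpace Z] [PseudoMetricSpace Z]

omit [MeasurableSpace Z] in
theorem lipschitzWith_toNNReal_lipNorm {g : Z → ℝ} (h : lipNorm g ≠ ∞) :
    LipschitzWith (lipNorm g).toNNReal g := by
  intro x y
  rw [ENNReal.coe_toNNReal h]
  -- Multiplication by zero does not commute with an infimum of extended numbers, so points at
  -- distance zero are treated through a single Lipschitz constant.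
  by_cases hxy : edist x y = 0
  · have : ∃ K : ℝ≥0, LipschitzWith K g := by
      by_contra hne
      push Not at hne
      exact h (by simp [lipNorm, hne])
    obtain ⟨K, hK⟩ := this
    have := hK x y
    rw [hxy, mul_zero] at this
    exact this.trans zero_le
  · simp only [lipNorm]
    rw [ENNReal.iInf_mul_of_ne hxy (edist_ne_top x y)]
    refine le_iInf fun K => ?_
    rw [ENNReal.iInf_mul_of_ne hxy (edist_ne_top x y)]
    exact le_iInf fun hK => hK x y

/-- The easy half of Kantorovich duality. Integrability passes from `P` to `Q` by writing `g x = (g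
x - g y) + g y` under the coupling. -/
theorem integral_sub_le_of_mem_couplings {P Q : Measure Z} [IsProbabilityMeasure P]
    [OpensMeasurableSpace Z] [SecondCountableTopology Z]
    {g : Z → ℝ} {K : ℝ≥0} (hK : LipschitzWith K g) (hP : Integrable g P)
    {γ : Measure (Z × Z)} (hγ : γ ∈ couplings Q P) (hfin : ∫⁻ p, edist p.1 p.2 ∂γ ≠ ∞) :
    Integrable g Q ∧
      ENNReal.ofReal (∫ z, g z ∂Q - ∫ z, g z ∂P) ≤ K * ∫⁻ p, edist p.1 p.2 ∂γ := by
  have hgm : Measurable g := hK.continuous.measurable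
  have hcost : ∫⁻ p, ‖g p.1 - g p.2‖ₑ ∂γ ≤ K * ∫⁻ p, edist p.1 p.2 ∂γ := by
    rw [← lintegral_const_mul _ measurable_edist_pair]
    refine lintegral_mono fun p => ?_
    rw [← edist_eq_enorm_sub]
    exact hK p.1 p.2
  have hsnd : Integrable (fun p : Z × Z => g p.2) γ := by
    have : Integrable g (γ.map Prod.snd) := hγ.2 ▸ hP
    exact this.comp_measurable measurable_snd
  have hdiff : Integrable (fun p : Z × Z => g p.1 - g p.2) γ :=
    ⟨((hgm.comp measurable_fst).sub (hgm.comp measurable_snd)).aestronglyMeasurable,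
      hcost.trans_lt (ENNReal.mul_lt_top ENNReal.coe_lt_top hfin.lt_top)⟩
  have hfst : Integrable (fun p : Z × Z => g p.1) γ := by
    exact (hdiff.add hsnd).congr (ae_of_all _ fun p => by simp)
  have hQ : Integrable g Q := by
    rw [← hγ.1]
    exact (integrable_map_measure hgm.aestronglyMeasurable measurable_fst.aemeasurable).2 hfst
  refine ⟨hQ, ?_⟩
  have e1 : ∫ z, g z ∂Q = ∫ p, g p.1 ∂γ := by
    rw [← hγ.1, integral_map measurable_fst.aemeasurable hgm.aestronglyMeasurable]
  have e2 : ∫ z, g z ∂P = ∫ p, g p.2 ∂γ := by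
    rw [← hγ.2, integral_map measurable_snd.aemeasurable hgm.aestronglyMeasurable]
  rw [e1, e2, ← integral_sub hfst hsnd]
  calc ENNReal.ofReal (∫ p, (g p.1 - g p.2) ∂γ) ≤ ‖∫ p, (g p.1 - g p.2) ∂γ‖ₑ :=
        Real.ofReal_le_enorm _
    _ ≤ ∫⁻ p, ‖g p.1 - g p.2‖ₑ ∂γ := enorm_integral_le_lintegral_enorm _
    _ ≤ _ := hcost

theorem integral_sub_le_W1 {P Q : Measure Z} [IsProbabilityMeasure P]
    [OpensMeasurableSpace Z] [SecondCountableTopology Z]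
    {g : Z → ℝ} {K : ℝ≥0} (hK : LipschitzWith K g) (hP : Integrable g P)
    (hfin : W1 Q P ≠ ∞) :
    Integrable g Q ∧ ENNReal.ofReal (∫ z, g z ∂Q - ∫ z, g z ∂P) ≤ K * W1 Q P := by
  obtain ⟨γ, hγ, hlt⟩ := exists_coupling_of_W1_lt hfin.lt_top
  refine ⟨(integral_sub_le_of_mem_couplings hK hP hγ hlt.ne).1, ?_⟩
  refine ENNReal.le_of_forall_pos_le_add fun ε hε _ => ?_
  -- No optimal coupling is assumed to exist; the slack `ε / (K + 1)` stays meaningful when `K = 0`.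
  have hpos : (0 : ℝ≥0∞) < ε / (K + 1) := by
    refine ENNReal.div_pos (by simpa using hε.ne') (by simp)
  obtain ⟨γ, hγ, hlt⟩ := exists_coupling_of_W1_lt (ENNReal.lt_add_right hfin hpos.ne')
  refine (integral_sub_le_of_mem_couplings hK hP hγ (hlt.trans_le le_top).ne).2.trans ?_
  refine (mul_le_mul_right hlt.le _).trans ?_
  rw [mul_add]
  gcongr
  calc (K : ℝ≥0∞) * (ε / (K + 1)) ≤ (K + 1) * (ε / (K + 1)) := by gcongr; exact le_self_add
    _ ≤ ε := ENNReal.mul_div_le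

variable [OpensMeasurableSpace Z] [SecondCountableTopology Z] [StandardBorelSpace Z]

/-- The factor two is the diameter of the ball: any `Q` in it reaches `P` through the center `P₀`.
-/
theorem worstCase_le_of_lipschitzWith {P P₀ : Measure Z} [IsProbabilityMeasure P]
    [IsProbabilityMeasure P₀] {η : ℝ} (hη : 0 ≤ η) (h : W1 P₀ P ≤ ENNReal.ofReal η)
    {g : Z → ℝ} {K : ℝ≥0} (hK : LipschitzWith K g) (hP : Integrable g P) :
    worstCase P₀ η g ≤ ((∫ z, g z ∂P + 2 * K * η : ℝ) : EReal) := by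
  refine iSup₂_le fun Q hQ => ?_
  have := hQ.1
  have hW : W1 Q P ≤ ENNReal.ofReal (2 * η) := by
    refine (W1_triangle Q P₀ P).trans ((add_le_add hQ.2 h).trans ?_)
    rw [← ENNReal.ofReal_add hη hη, two_mul]
  obtain ⟨hint, hle⟩ := integral_sub_le_W1 hK hP (hW.trans_lt ENNReal.ofReal_lt_top).ne
  rw [expect_eq_integral hint, EReal.coe_le_coe_iff]
  have h3 : ENNReal.ofReal (∫ z, g z ∂Q - ∫ z, g z ∂P) ≤ ENNReal.ofReal (K * (2 * η)) := by
    rw [ENNReal.ofReal_mul K.coe_nonneg, ENNReal.ofReal_coe_nnreal]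
    exact hle.trans (by gcongr)
  have := (ENNReal.ofReal_le_ofReal_iff (by positivity)).1 h3
  linarith

theorem expect_sub_le_of_isDROSolution {F : Type*} {ℓ : F → Z → ℝ} {P P₀ : Measure Z}
    [IsProbabilityMeasure P] [IsProbabilityMeasure P₀] {η : ℝ} (hη : 0 < η)
    (h : W1 P₀ P ≤ ENNReal.ofReal η)
    (hlip : ∀ (g : Z → ℝ) (K : ℝ≥0), LipschitzWith K g → Integrable g P)
    (f₀ : F) {f : F} (hf : IsDROSolution ℓ P₀ η f) :
    expect P (ℓ f) - expect P (ℓ f₀) ≤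
      ((2 * lipNorm (ℓ f₀) * ENNReal.ofReal η : ℝ≥0∞) : EReal) := by
  -- Here `0 < η` matters: the right side is then `∞`, whereas `∞ * 0` would be `0`.
  by_cases hL : lipNorm (ℓ f₀) = ∞
  · rw [hL, ENNReal.mul_top (by simp), ENNReal.top_mul (by simpa using hη)]
    simp
  have hK := lipschitzWith_toNNReal_lipNorm hL
  have hint := hlip _ _ hK
  have h1 : expect P (ℓ f) ≤ worstCase P₀ η (ℓ f) :=
    le_iSup₂_of_le P ⟨inferInstance, W1_comm P₀ P ▸ h⟩ le_rfl
  have h2 := (h1.trans (hf f₀)).trans (worstCase_le_of_lipschitzWith hη.le h hK hint)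
  rw [expect_eq_integral hint]
  have h3 : ((2 * lipNorm (ℓ f₀) * ENNReal.ofReal η : ℝ≥0∞) : EReal) =
      ((2 * (lipNorm (ℓ f₀)).toNNReal * η : ℝ) : EReal) := by
    have hne : 2 * lipNorm (ℓ f₀) * ENNReal.ofReal η ≠ ∞ := by finiteness
    rw [← EReal.coe_ennreal_toReal hne]
    simp [ENNReal.toReal_mul, hη.le, ENNReal.coe_toNNReal_eq_toReal]
  rw [h3]
  refine (EReal.sub_le_sub h2 le_rfl).trans ?_
  rw [← EReal.coe_sub, EReal.coe_le_coe_iff]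
  linarith

end DRO

/-! ### Exponential moments of Lipschitz functions of independent variables. -/

section Concentration

/-- Termwise comparison of Taylor series: `c ^ (2k) ≤ c ^ 2` for `k ≥ 1`. -/
theorem cosh_mul_le {c : ℝ} (hc : 0 ≤ c) (hc1 : c ≤ 1) (x : ℝ) :
    Real.cosh (c * x) ≤ 1 + c ^ 2 * Real.cosh x := by
  have h1 := Real.hasSum_cosh (c * x)
  have h2 := ((hasSum_ite_eq (0 : ℕ) (1 : ℝ))).add ((Real.hasSum_cosh x).mul_left (c ^ 2))
  refine hasSum_le (fun n => ?_) h1 h2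
  rcases n with _ | n
  · simp; positivity
  · have : c ^ (2 * (n + 1)) ≤ c ^ 2 := pow_le_pow_of_le_one hc hc1 (by omega)
    simp only [Nat.add_eq_zero_iff, one_ne_zero, and_false, if_false, zero_add, mul_pow]
    rw [← mul_div_assoc]
    have h0 : (0 : ℝ) ≤ x ^ (2 * (n + 1)) := by rw [pow_mul]; positivity
    gcongr

variable {Z : Type*} [MeasurableSpace Z] [PseudoMetricSpace Z] [OpensMeasurableSpace Z]
  [SecondCountableTopology Z]

omit [OpensMeasurableSpace Z] in
-- Symmetrization: by Jensen, `exp (-E g) ≤ E exp (-g)`, so with an independent copy `X'` one gets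
-- `E exp (g - E g) ≤ E cosh (g X - g X') ≤ 1 + c² K ≤ exp (c² K)`. The odd part cancels, which
-- leaves a cost quadratic in `c`.
theorem integral_exp_le_of_lipschitz {P : Measure Z} [IsProbabilityMeasure P] {K : ℝ}
    (hcosh : Integrable (fun p : Z × Z => Real.cosh (dist p.1 p.2)) (P.prod P))
    (hK : ∫ p : Z × Z, Real.cosh (dist p.1 p.2) ∂(P.prod P) ≤ K)
    {c : ℝ} (hc : 0 ≤ c) (hc1 : c ≤ 1) {g : Z → ℝ} (hg : ∀ x y, |g x - g y| ≤ c * dist x y)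
    (hgi : Integrable g P) (hexp : Integrable (fun z => Real.exp (g z)) P)
    (hexp' : Integrable (fun z => Real.exp (-g z)) P) :
    ∫ z, Real.exp (g z) ∂P ≤ Real.exp (∫ z, g z ∂P + c ^ 2 * K) := by
  have hprod : Integrable (fun p : Z × Z => Real.exp (g p.1) * Real.exp (-g p.2)) (P.prod P) :=
    hexp.mul_prod hexp'
  have hprod' : Integrable (fun p : Z × Z => Real.exp (-g p.1) * Real.exp (g p.2)) (P.prod P) :=
    hexp'.mul_prod hexp
  have hjensen : Real.exp (-∫ z, g z ∂P) ≤ ∫ z, Real.exp (-g z) ∂P := by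
    rw [← integral_neg]
    exact convexOn_exp.map_integral_le Real.continuous_exp.continuousOn isClosed_univ
      (by simp) hgi.neg hexp'
  have hI : (∫ z, Real.exp (g z) ∂P) * ∫ z, Real.exp (-g z) ∂P =
      ∫ p : Z × Z, Real.cosh (g p.1 - g p.2) ∂(P.prod P) := by
    have e1 := integral_prod_mul (μ := P) (ν := P) (fun z => Real.exp (g z))
      (fun z => Real.exp (-g z))
    have e2 := integral_prod_mul (μ := P) (ν := P) (fun z => Real.exp (-g z))
      (fun z => Real.exp (g z))
    have e3 : ∫ p : Z × Z, Real.cosh (g p.1 - g p.2) ∂(P.prod P) =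
        ∫ p : Z × Z, (Real.exp (g p.1) * Real.exp (-g p.2)
          + Real.exp (-g p.1) * Real.exp (g p.2)) / 2 ∂(P.prod P) := by
      congr 1
      ext p
      rw [Real.cosh_eq, ← Real.exp_add, ← Real.exp_add]
      congr 3
      ring
    rw [e3, integral_div, integral_add hprod hprod', e1, e2]
    ring
  have hle : ∫ p : Z × Z, Real.cosh (g p.1 - g p.2) ∂(P.prod P) ≤ 1 + c ^ 2 * K := by
    have hb : Integrable (fun p : Z × Z => 1 + c ^ 2 * Real.cosh (dist p.1 p.2)) (P.prod P) :=
      (integrable_const 1).add (hcosh.const_mul _)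
    calc ∫ p : Z × Z, Real.cosh (g p.1 - g p.2) ∂(P.prod P)
        ≤ ∫ p : Z × Z, (1 + c ^ 2 * Real.cosh (dist p.1 p.2)) ∂(P.prod P) := by
          refine integral_mono_of_nonneg (ae_of_all _ fun p => (Real.cosh_pos _).le) hb
            (ae_of_all _ fun p => ?_)
          refine le_trans ?_ (cosh_mul_le hc hc1 (dist p.1 p.2))
          rw [Real.cosh_le_cosh, abs_of_nonneg (by positivity : 0 ≤ c * dist p.1 p.2)]
          exact hg _ _
      _ ≤ 1 + c ^ 2 * K := by
          rw [integral_add (integrable_const 1) (hcosh.const_mul _), integral_const_mul]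
          simp only [integral_const, probReal_univ, smul_eq_mul, mul_one]
          gcongr
  have h0 : 0 ≤ ∫ z, Real.exp (g z) ∂P := integral_nonneg fun z => (Real.exp_pos _).le
  have hfin : (∫ z, Real.exp (g z) ∂P) * Real.exp (-∫ z, g z ∂P) ≤ Real.exp (c ^ 2 * K) :=
    (mul_le_mul_of_nonneg_left hjensen h0).trans <| (hI.le.trans hle).trans <| by
      have := Real.add_one_le_exp (c ^ 2 * K); linarith
  rw [Real.exp_neg, ← div_eq_mul_inv, div_le_iff₀ (Real.exp_pos _), ← Real.exp_add] at hfin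
  rwa [add_comm]

omit [MeasurableSpace Z] [OpensMeasurableSpace Z] [SecondCountableTopology Z] in
theorem continuous_of_abs_sub_le_sum_dist {n : ℕ} {f : (Fin n → Z) → ℝ}
    (hf : ∀ x y, |f x - f y| ≤ ∑ i, dist (x i) (y i)) : Continuous f := by
  refine (LipschitzWith.of_dist_le_mul (K := n) fun x y => ?_).continuous
  rw [Real.dist_eq]
  refine (hf x y).trans ((Finset.sum_le_sum fun i _ => dist_le_pi_dist x y i).trans ?_)
  simp

theorem integrable_exp_pi {P : Measure Z} [IsProbabilityMeasure P] {z₀ : Z}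
    (h₀ : Integrable (fun z => Real.exp (dist z z₀)) P) {n : ℕ}
    {c : ℝ} (hc1 : c ≤ 1) {f : (Fin n → Z) → ℝ}
    (hf : ∀ x y, |f x - f y| ≤ c * ∑ i, dist (x i) (y i)) :
    Integrable (fun x => Real.exp (f x)) (Measure.pi fun _ => P) := by
  have hf1 : ∀ x y, |f x - f y| ≤ ∑ i, dist (x i) (y i) := fun x y =>
    (hf x y).trans (mul_le_of_le_one_left (Finset.sum_nonneg fun _ _ => dist_nonneg) hc1)
  have hcont : Continuous f := continuous_of_abs_sub_le_sum_dist hf1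
  have hb : Integrable (fun x : Fin n → Z =>
      Real.exp (f fun _ => z₀) * ∏ i, Real.exp (dist (x i) z₀)) (Measure.pi fun _ => P) :=
    (Integrable.fintype_prod (f := fun _ z => Real.exp (dist z z₀)) fun _ => h₀).const_mul _
  refine hb.mono' (Real.continuous_exp.comp hcont).measurable.aestronglyMeasurable
    (ae_of_all _ fun x => ?_)
  rw [Real.norm_eq_abs, abs_of_pos (Real.exp_pos _), ← Real.exp_sum, ← Real.exp_add,
    Real.exp_le_exp]
  have := (abs_le.1 (hf1 x fun _ => z₀)).2
  linarith

theorem integrable_pi {P : Measure Z} [IsProbabilityMeasure P] {z₀ : Z}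
    (h₀ : Integrable (fun z => Real.exp (dist z z₀)) P) {n : ℕ}
    {c : ℝ} (hc1 : c ≤ 1) {f : (Fin n → Z) → ℝ} (hfm : Measurable f)
    (hf : ∀ x y, |f x - f y| ≤ c * ∑ i, dist (x i) (y i)) :
    Integrable f (Measure.pi fun _ => P) := by
  have h1 := integrable_exp_pi h₀ hc1 hf
  have h2 := integrable_exp_pi h₀ hc1 (f := fun x => -f x) fun x y => by
    rw [← abs_neg]
    convert! hf x y using 2
    ring
  refine (h1.add h2).mono' hfm.aestronglyMeasurable (ae_of_all _ fun x => ?_)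
  have e1 := Real.add_one_le_exp (f x)
  have e2 := Real.add_one_le_exp (-f x)
  have e3 := Real.exp_pos (f x)
  have e4 := Real.exp_pos (-f x)
  simp only [Pi.add_apply, Real.norm_eq_abs]
  rcases abs_cases (f x) with h | h <;> linarith

omit [PseudoMetricSpace Z] [OpensMeasurableSpace Z] [SecondCountableTopology Z] in
theorem integral_piFinSucc {P : Measure Z} [IsProbabilityMeasure P] {n : ℕ}
    {f : (Fin (n + 1) → Z) → ℝ} (hf : Integrable f (Measure.pi fun _ => P)) :
    Integrable (fun p : Z × (Fin n → Z) => f (Fin.cons p.1 p.2))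
      (P.prod (Measure.pi fun _ => P)) ∧
    ∫ x, f x ∂(Measure.pi fun _ => P) =
      ∫ z, ∫ x : Fin n → Z, f (Fin.cons z x) ∂(Measure.pi fun _ => P) ∂P := by
  have hmp := (measurePreserving_piFinSuccAbove (fun _ : Fin (n + 1) => P) 0).symm
  have hi : Integrable (fun p : Z × (Fin n → Z) => f (Fin.cons p.1 p.2))
      (P.prod (Measure.pi fun _ => P)) := by
    have := (hmp.integrable_comp_emb (MeasurableEquiv.measurableEmbedding _)).2 hf
    refine this.congr (ae_of_all _ fun p => ?_)
    simp [MeasurableEquiv.piFinSuccAbove, Fin.insertNthEquiv]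
  refine ⟨hi, ?_⟩
  rw [← hmp.integral_comp', ← integral_prod _ hi]
  congr 1
  ext p
  simp [MeasurableEquiv.piFinSuccAbove, Fin.insertNthEquiv]

/-- Induction on the number of variables. Averaging over all but the first coordinate leaves a
`c`-Lipschitz function of that coordinate, so each coordinate costs one factor `exp (c² K)`. -/
theorem integral_exp_pi_le {P : Measure Z} [IsProbabilityMeasure P] {K : ℝ} {z₀ : Z}
    (h₀ : Integrable (fun z => Real.exp (dist z z₀)) P)
    (hcosh : Integrable (fun p : Z × Z => Real.cosh (dist p.1 p.2)) (P.prod P))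
    (hK : ∫ p : Z × Z, Real.cosh (dist p.1 p.2) ∂(P.prod P) ≤ K)
    {c : ℝ} (hc : 0 ≤ c) (hc1 : c ≤ 1) (n : ℕ) {f : (Fin n → Z) → ℝ} (hfm : Measurable f)
    (hf : ∀ x y, |f x - f y| ≤ c * ∑ i, dist (x i) (y i)) :
    ∫ x, Real.exp (f x) ∂(Measure.pi fun _ => P) ≤
      Real.exp (∫ x, f x ∂(Measure.pi fun _ => P) + n * (c ^ 2 * K)) := by
  induction n with
  | zero =>
    have : ∀ x, f x = f default := fun x => congrArg f (Subsingleton.elim _ _)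
    simp only [this]
    simp
  | succ n ih =>
    have hfi := integrable_pi h₀ hc1 hfm hf
    have hei := integrable_exp_pi h₀ hc1 hf
    obtain ⟨hfp, hfeq⟩ := integral_piFinSucc hfi
    obtain ⟨hep, heeq⟩ := integral_piFinSucc hei
    have hm : ∀ z, Measurable fun x : Fin n → Z => f (Fin.cons z x) := fun z =>
      hfm.comp (measurable_pi_iff.2 fun i => by
        refine Fin.cases ?_ (fun j => ?_) i
        · simp
        · simpa using measurable_pi_apply j)
    have hl : ∀ z, ∀ x y : Fin n → Z, |f (Fin.cons z x) - f (Fin.cons z y)| ≤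
        c * ∑ i, dist (x i) (y i) := fun z x y => by
      simpa [Fin.sum_univ_succ] using hf (Fin.cons z x) (Fin.cons z y)
    have hi : ∀ z, Integrable (fun x : Fin n → Z => f (Fin.cons z x)) (Measure.pi fun _ => P) :=
      fun z => integrable_pi h₀ hc1 (hm z) (hl z)
    set g : Z → ℝ := fun z => ∫ x : Fin n → Z, f (Fin.cons z x) ∂(Measure.pi fun _ => P) with hg
    have hglip : ∀ z z', |g z - g z'| ≤ c * dist z z' := fun z z' => by
      rw [hg]
      simp only
      rw [← integral_sub (hi z) (hi z')]
      refine (abs_integral_le_integral_abs).trans ?_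
      refine (integral_mono_of_nonneg (ae_of_all _ fun x => abs_nonneg _)
        (integrable_const (c * dist z z')) (ae_of_all _ fun x => ?_)).trans (by simp)
      simpa [Fin.sum_univ_succ] using hf (Fin.cons z x) (Fin.cons z' x)
    have hdom : ∀ h : Z → ℝ, (∀ z z', |h z - h z'| ≤ c * dist z z') →
        Integrable (fun z => Real.exp (h z)) P := fun h hh => by
      have hhm : Measurable h := by
        refine (LipschitzWith.of_dist_le_mul (K := 1) fun x y => ?_).continuous.measurable
        rw [Real.dist_eq]
        refine (hh x y).trans ?_
        simpa using mul_le_of_le_one_left dist_nonneg hc1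
      refine (h₀.const_mul (Real.exp (h z₀))).mono'
        (Real.measurable_exp.comp hhm).aestronglyMeasurable (ae_of_all _ fun z => ?_)
      rw [Real.norm_eq_abs, abs_of_pos (Real.exp_pos _), ← Real.exp_add, Real.exp_le_exp]
      have h1 := (abs_le.1 (hh z z₀)).2
      have h2 : c * dist z z₀ ≤ dist z z₀ := mul_le_of_le_one_left dist_nonneg hc1
      linarith
    have hg1 := hdom g hglip
    have hg2 := hdom (fun z => -g z) fun z z' => by
      rw [← abs_neg]
      convert! hglip z z' using 2
      ring
    have hgi : Integrable g P := hfp.integral_prod_left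
    have key := integral_exp_le_of_lipschitz hcosh hK hc hc1 hglip hgi hg1 hg2
    rw [heeq, hfeq]
    calc ∫ z, ∫ x : Fin n → Z, Real.exp (f (Fin.cons z x)) ∂(Measure.pi fun _ => P) ∂P
        ≤ ∫ z, Real.exp (n * (c ^ 2 * K)) * Real.exp (g z) ∂P := by
          refine integral_mono_of_nonneg
            (ae_of_all _ fun z => integral_nonneg fun x => (Real.exp_pos _).le)
            (hg1.const_mul _) (ae_of_all _ fun z => ?_)
          refine (ih (hm z) (hl z)).trans (le_of_eq ?_)
          simp only [hg]
          rw [← Real.exp_add, add_comm]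
      _ ≤ Real.exp (n * (c ^ 2 * K)) * Real.exp (∫ z, g z ∂P + c ^ 2 * K) := by
          rw [integral_const_mul]
          gcongr
      _ = _ := by
          rw [← Real.exp_add]
          congr 1
          push_cast
          ring

end Concentration

/-! ### Transport along a tree of cells. -/

section Tree

variable {I : Type*} [MeasurableSpace I] [Countable I] [MeasurableSingletonClass I]

/-- The absolute difference of two extended nonnegative numbers. -/
noncomputable def absDiff (x y : ℝ≥0∞) : ℝ≥0∞ := (x - y) + (y - x)

theorem absDiff_add_left {c : ℝ≥0∞} (hc : c ≠ ∞) (x y : ℝ≥0∞) :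
    absDiff (c + x) (c + y) = absDiff x y := by
  simp [absDiff, ENNReal.add_sub_add_eq_sub_left hc]

/-- The common part is the pointwise minimum of the masses, and the excesses are the truncated
differences; their sum is `absDiff`. -/
theorem exists_common_part (a b : Measure I) [IsFiniteMeasure a] [IsFiniteMeasure b] :
    ∃ m e₁ e₂ : Measure I, a = m + e₁ ∧ b = m + e₂ ∧
      (∀ k, e₁ {k} = a {k} - b {k}) ∧ ∀ k, e₂ {k} = b {k} - a {k} := by
  have hs : ∀ (w : I → ℝ≥0∞) (k : I), (Measure.sum fun i => w i • Measure.dirac i) {k} = w k := by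
    intro w k
    rw [Measure.sum_apply _ (measurableSet_singleton k), tsum_eq_single k]
    · simp
    · intro i hi
      simp [hi]
  refine ⟨Measure.sum fun i => min (a {i}) (b {i}) • Measure.dirac i,
    Measure.sum fun i => (a {i} - b {i}) • Measure.dirac i,
    Measure.sum fun i => (b {i} - a {i}) • Measure.dirac i, ?_, ?_, hs _, hs _⟩
  · refine Measure.ext_of_singleton fun k => ?_
    rw [Measure.add_apply, hs, hs]
    rcases le_total (a {k}) (b {k}) with h | h <;>
      simp [h, tsub_eq_zero_of_le, add_tsub_cancel_of_le]
  · refine Measure.ext_of_singleton fun k => ?_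
    rw [Measure.add_apply, hs, hs]
    rcases le_total (a {k}) (b {k}) with h | h <;>
      simp [h, tsub_eq_zero_of_le, add_tsub_cancel_of_le]

variable {Z : Type*} [MeasurableSpace Z] [PseudoEMetricSpace Z] [OpensMeasurableSpace Z]
  [SecondCountableTopology Z] [StandardBorelSpace Z]

/-- The common mass `m` stays put. The excesses go from `e₁` to its image under `p`, then to the
image of `e₂`, then back to `e₂`. -/
theorem W1_map_le_of_excess {m e₁ e₂ : Measure I} [IsFiniteMeasure e₁] [IsFiniteMeasure e₂]
    {s : I → Z} {p : Z → Z} (hp : Measurable p) :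
    W1 ((m + e₁).map s) ((m + e₂).map s) ≤ W1 ((e₁.map s).map p) ((e₂.map s).map p) +
      ∑' k, edist (s k) (p (s k)) * (e₁ {k} + e₂ {k}) := by
  have hs : Measurable s := measurable_of_countable s
  rw [Measure.map_add _ _ hs, Measure.map_add _ _ hs]
  refine (W1_add_le _ _ _ _).trans ?_
  rw [W1_self, zero_add]
  have hmove : ∀ e : Measure I, W1 (e.map s) ((e.map s).map p) ≤
      ∑' k, edist (s k) (p (s k)) * e {k} := fun e => by
    rw [Measure.map_map hp hs]
    refine (W1_map_map_le e hs (hp.comp hs)).trans (le_of_eq ?_)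
    rw [lintegral_countable']
    rfl
  calc W1 (e₁.map s) (e₂.map s)
      ≤ W1 (e₁.map s) ((e₁.map s).map p) + W1 ((e₁.map s).map p) (e₂.map s) :=
        W1_triangle _ _ _
    _ ≤ W1 (e₁.map s) ((e₁.map s).map p) +
          (W1 ((e₁.map s).map p) ((e₂.map s).map p) + W1 ((e₂.map s).map p) (e₂.map s)) := by
        gcongr
        exact W1_triangle _ _ _
    _ ≤ ∑' k, edist (s k) (p (s k)) * e₁ {k} +
          (W1 ((e₁.map s).map p) ((e₂.map s).map p) +
            ∑' k, edist (s k) (p (s k)) * e₂ {k}) := by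
        gcongr
        · exact hmove e₁
        · rw [W1_comm]; exact hmove e₂
    _ = _ := by
        simp_rw [mul_add]
        rw [ENNReal.tsum_add]
        ring

/-- At the finest level only the excess moves, to the representatives of the coarser cells; what
remains is the same problem one level up for the two excesses. These are not probabilities, hence
the general equal masses. -/
theorem W1_map_le_sum_cells {k : ℕ → Z → I} {s : ℕ → I → Z} (hk : ∀ j, Measurable (k j))
    (hks : ∀ i j, i ≤ j → ∀ z, k i (s j (k j z)) = k i z) (z₀ : Z) (L : ℕ) (μ ν : Measure Z)
    [IsFiniteMeasure μ] [IsFiniteMeasure ν] (h : μ Set.univ = ν Set.univ) :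
    W1 (μ.map fun z => s L (k L z)) (ν.map fun z => s L (k L z)) ≤
      ∑ j ∈ Finset.range L, ∑' q, edist (s (j + 1) q) (s j (k j (s (j + 1) q))) *
          absDiff (μ (k (j + 1) ⁻¹' {q})) (ν (k (j + 1) ⁻¹' {q})) +
        ∑' q, edist (s 0 q) z₀ * absDiff (μ (k 0 ⁻¹' {q})) (ν (k 0 ⁻¹' {q})) := by
  have hmap : ∀ (j : ℕ) (ρ : Measure Z), (ρ.map fun z => s j (k j z)) = (ρ.map (k j)).map (s j) :=
    fun j ρ => by rw [Measure.map_map (measurable_of_countable _) (hk j)]; rfl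
  have hsing : ∀ (j : ℕ) (ρ : Measure Z) q, ρ (k j ⁻¹' {q}) = (ρ.map (k j)) {q} :=
    fun j ρ q => (Measure.map_apply (hk j) (measurableSet_singleton q)).symm
  induction L generalizing μ ν with
  | zero =>
    rw [hmap, hmap]
    obtain ⟨m, e₁, e₂, h₁, h₂, hd₁, hd₂⟩ := exists_common_part (μ.map (k 0)) (ν.map (k 0))
    have hfa : IsFiniteMeasure (m + e₁) := h₁ ▸ inferInstance
    have hfb : IsFiniteMeasure (m + e₂) := h₂ ▸ inferInstance
    have : IsFiniteMeasure m := isFiniteMeasure_of_le (m + e₁) (Measure.le_add_right le_rfl)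
    have : IsFiniteMeasure e₁ := isFiniteMeasure_of_le (m + e₁) (Measure.le_add_left le_rfl)
    have : IsFiniteMeasure e₂ := isFiniteMeasure_of_le (m + e₂) (Measure.le_add_left le_rfl)
    have hs : Measurable (s 0) := measurable_of_countable _
    have hmass : e₁ Set.univ = e₂ Set.univ := by
      have e1 := congrArg (fun ρ => ρ Set.univ) h₁
      have e2 := congrArg (fun ρ => ρ Set.univ) h₂
      simp only [Measure.map_apply (hk 0) MeasurableSet.univ, Set.preimage_univ,
        Measure.add_apply] at e1 e2
      exact (ENNReal.add_right_inj (measure_ne_top m _)).1 (e1 ▸ e2 ▸ h)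
    simp only [hsing, absDiff, ← hd₁, ← hd₂]
    rw [h₁, h₂]
    -- At the root both excesses are gathered at `z₀`, where equal masses make them coincide.
    refine (W1_map_le_of_excess (p := fun _ => z₀) measurable_const).trans (le_of_eq ?_)
    rw [Measure.map_const, Measure.map_const, Measure.map_apply hs MeasurableSet.univ,
      Measure.map_apply hs MeasurableSet.univ, Set.preimage_univ, hmass, W1_self]
    simp
  | succ L ih =>
    rw [hmap, hmap]
    obtain ⟨m, e₁, e₂, h₁, h₂, hd₁, hd₂⟩ :=
      exists_common_part (μ.map (k (L + 1))) (ν.map (k (L + 1)))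
    have hfa : IsFiniteMeasure (m + e₁) := h₁ ▸ inferInstance
    have hfb : IsFiniteMeasure (m + e₂) := h₂ ▸ inferInstance
    have : IsFiniteMeasure m := isFiniteMeasure_of_le (m + e₁) (Measure.le_add_right le_rfl)
    have : IsFiniteMeasure e₁ := isFiniteMeasure_of_le (m + e₁) (Measure.le_add_left le_rfl)
    have : IsFiniteMeasure e₂ := isFiniteMeasure_of_le (m + e₂) (Measure.le_add_left le_rfl)
    have hs : Measurable (s (L + 1)) := measurable_of_countable _
    have hmass : e₁ Set.univ = e₂ Set.univ := by
      have e1 := congrArg (fun ρ => ρ Set.univ) h₁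
      have e2 := congrArg (fun ρ => ρ Set.univ) h₂
      simp only [Measure.map_apply (hk (L + 1)) MeasurableSet.univ, Set.preimage_univ,
        Measure.add_apply] at e1 e2
      exact (ENNReal.add_right_inj (measure_ne_top m _)).1 (e1 ▸ e2 ▸ h)
    -- Rounding to a finer representative does not change the coarser cell, so coarse masses split
    -- into common part plus excess, and the common part cancels in `absDiff`.
    have hcell : ∀ (ρ : Measure Z) (e : Measure I), ρ.map (k (L + 1)) = m + e → ∀ j ≤ L, ∀ q,
        ρ (k j ⁻¹' {q}) = (m.map (s (L + 1))) (k j ⁻¹' {q}) +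
          (e.map (s (L + 1))) (k j ⁻¹' {q}) := by
      intro ρ e he j hj q
      rw [← Measure.add_apply, ← Measure.map_add _ _ hs, ← he, ← hmap,
        Measure.map_apply (show Measurable fun z => s (L + 1) (k (L + 1) z) from
          hs.comp (hk (L + 1))) (hk j (measurableSet_singleton q))]
      congr 1
      ext z
      simp [hks j (L + 1) (by omega) z]
    have hdiff : ∀ j ≤ L, ∀ q, absDiff (μ (k j ⁻¹' {q})) (ν (k j ⁻¹' {q})) =
        absDiff ((e₁.map (s (L + 1))) (k j ⁻¹' {q})) ((e₂.map (s (L + 1))) (k j ⁻¹' {q})) := by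
      intro j hj q
      rw [hcell μ e₁ h₁ j hj q, hcell ν e₂ h₂ j hj q, absDiff_add_left (measure_ne_top _ _)]
    have hih := ih (e₁.map (s (L + 1))) (e₂.map (s (L + 1))) (by
      rw [Measure.map_apply hs MeasurableSet.univ, Measure.map_apply hs MeasurableSet.univ,
        Set.preimage_univ, hmass])
    rw [Finset.sum_range_succ]
    have hlast : ∀ q, absDiff (μ (k (L + 1) ⁻¹' {q})) (ν (k (L + 1) ⁻¹' {q})) =
        e₁ {q} + e₂ {q} := fun q => by rw [hsing, hsing, absDiff, hd₁, hd₂]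
    simp only [hlast]
    rw [h₁, h₂]
    refine (W1_map_le_of_excess (p := fun z => s L (k L z))
      ((measurable_of_countable _).comp (hk L))).trans ?_
    refine (add_le_add_left hih _).trans (le_of_eq ?_)
    rw [Finset.sum_congr rfl fun j hj => by
      simp only [← hdiff (j + 1) (Finset.mem_range.1 hj)]; rfl]
    simp only [← hdiff 0 (Nat.zero_le L)]
    ring

/-- Rounding each measure to the representatives of level `L` costs at most `r`, hence `2 * r`. -/
theorem W1_le_sum_cells {k : ℕ → Z → I} {s : ℕ → I → Z} (hk : ∀ j, Measurable (k j))
    (hks : ∀ i j, i ≤ j → ∀ z, k i (s j (k j z)) = k i z) (z₀ : Z) (L : ℕ) {r : ℝ≥0∞}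
    (hr : ∀ z, edist z (s L (k L z)) ≤ r) (P Q : Measure Z)
    [IsProbabilityMeasure P] [IsProbabilityMeasure Q] :
    W1 P Q ≤ 2 * r +
      (∑ j ∈ Finset.range L, ∑' q, edist (s (j + 1) q) (s j (k j (s (j + 1) q))) *
          absDiff (P (k (j + 1) ⁻¹' {q})) (Q (k (j + 1) ⁻¹' {q})) +
        ∑' q, edist (s 0 q) z₀ * absDiff (P (k 0 ⁻¹' {q})) (Q (k 0 ⁻¹' {q}))) := by
  have hm : Measurable fun z => s L (k L z) := (measurable_of_countable _).comp (hk L)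
  have hmove : ∀ R : Measure Z, IsProbabilityMeasure R →
      W1 R (R.map fun z => s L (k L z)) ≤ r := fun R _ => by
    have := W1_map_map_le R measurable_id hm
    rw [Measure.map_id] at this
    refine this.trans ((lintegral_mono hr).trans ?_)
    simp
  have hP := hmove P inferInstance
  have hQ := hmove Q inferInstance
  rw [W1_comm] at hQ
  have h := W1_map_le_sum_cells hk hks z₀ L P Q (by simp)
  refine (W1_triangle P (P.map fun z => s L (k L z)) Q).trans ?_
  refine (add_le_add hP (W1_triangle _ (Q.map fun z => s L (k L z)) Q)).trans ?_
  refine (add_le_add le_rfl (add_le_add h hQ)).trans (le_of_eq ?_)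
  ring

end Tree

/-! ### Fluctuations of empirical cell masses. -/

section EmpiricalMass

variable {Z : Type*} [MeasurableSpace Z]

/-- Young's inequality `|u| ≤ t u² + 1/t` replaces Cauchy–Schwarz: the parameter `t` can be chosen
cell by cell, and the bound is linear in the variance. -/
theorem absDiff_le_ofReal {x y : ℝ≥0∞} (hx : x ≠ ∞) (hy : y ≠ ∞) {t : ℝ} (ht : 0 < t) :
    absDiff x y ≤ ENNReal.ofReal (t * (y.toReal - x.toReal) ^ 2) + ENNReal.ofReal t⁻¹ := by
  have hr : ∀ u : ℝ, u ≤ t * u ^ 2 + t⁻¹ := fun u => by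
    have h1 : t * u ^ 2 + t⁻¹ - u = t * (u - t⁻¹ / 2) ^ 2 + 3 / 4 * t⁻¹ := by
      field_simp
      ring
    have : 0 ≤ t * (u - t⁻¹ / 2) ^ 2 + 3 / 4 * t⁻¹ := by positivity
    linarith
  rw [← ENNReal.ofReal_add (by positivity) (by positivity)]
  have hsub : ∀ a b : ℝ≥0∞, a ≠ ∞ → b ≠ ∞ → a - b = ENNReal.ofReal (a.toReal - b.toReal) :=
    fun a b ha hb => by
      rw [ENNReal.ofReal_sub _ ENNReal.toReal_nonneg, ENNReal.ofReal_toReal ha,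
        ENNReal.ofReal_toReal hb]
  rcases le_total x y with h | h
  · rw [absDiff, tsub_eq_zero_of_le h, zero_add, hsub y x hy hx]
    exact ENNReal.ofReal_le_ofReal (hr _)
  · rw [absDiff, tsub_eq_zero_of_le h, add_zero, hsub x y hx hy]
    refine ENNReal.ofReal_le_ofReal ((hr _).trans (le_of_eq ?_))
    ring

theorem toReal_empirical_apply {n : ℕ} (x : Fin n → Z) {C : Set Z} (hC : MeasurableSet C) :
    (empirical x C).toReal = (n : ℝ)⁻¹ * ∑ i, C.indicator (fun _ => (1 : ℝ)) (x i) := by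
  simp only [empirical, Measure.smul_apply, Measure.finsetSum_apply, smul_eq_mul,
    ENNReal.toReal_mul, ENNReal.toReal_inv, ENNReal.toReal_natCast]
  rw [ENNReal.toReal_sum fun i _ => (measure_lt_top _ _).ne]
  congr 1
  refine Finset.sum_congr rfl fun i _ => ?_
  rw [Measure.dirac_apply' _ hC]
  by_cases h : x i ∈ C <;> simp [h]

/-- The left side is the variance of a mean of `n` independent indicators, each with second moment
`P C`. -/
theorem lintegral_sq_empirical_sub_le (P : Measure Z) [IsProbabilityMeasure P] {n : ℕ}
    (hn : 1 ≤ n) {C : Set Z} (hC : MeasurableSet C) :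
    ∫⁻ x, ENNReal.ofReal (((empirical x C).toReal - (P C).toReal) ^ 2)
      ∂(Measure.pi fun _ : Fin n => P) ≤ P C / n := by
  set X : Z → ℝ := C.indicator fun _ => (1 : ℝ) with hX
  have hXm : Measurable X := measurable_const.indicator hC
  have hX2 : MemLp X 2 P := (memLp_const 1).indicator hC
  set μ := Measure.pi fun _ : Fin n => P with hμ
  have hX2' : ∀ i : Fin n, MemLp (fun x : Fin n → Z => X (x i)) 2 μ := fun i =>
    hX2.comp_measurePreserving (measurePreserving_eval _ i)
  set Y : (Fin n → Z) → ℝ := fun x => (n : ℝ)⁻¹ * (∑ i, fun x : Fin n → Z => X (x i)) x with hY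
  have hYmem : MemLp Y 2 μ := (memLp_finsetSum' _ fun i _ => hX2' i).const_mul _
  have hn0 : (n : ℝ) ≠ 0 := by positivity
  have hXint : ∫ z, X z ∂P = (P C).toReal := by
    rw [hX, integral_indicator hC]; simp [Measure.real]
  have hmean : ∫ x, Y x ∂μ = (P C).toReal := by
    simp only [hY, Finset.sum_apply]
    rw [integral_const_mul, integral_finsetSum _ fun i _ => (hX2' i).integrable one_le_two]
    have : ∀ i : Fin n, ∫ x, X (x i) ∂μ = (P C).toReal := fun i => by
      rw [← hXint, ← (measurePreserving_eval (fun _ : Fin n => P) i).map_eq,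
        integral_map (measurable_pi_apply i).aemeasurable
        hXm.aestronglyMeasurable]
    simp only [this, Finset.sum_const, Finset.card_univ, Fintype.card_fin, nsmul_eq_mul]
    field_simp
  have hvarX : Var[X; P] ≤ (P C).toReal := by
    refine (variance_le_expectation_sq hXm.aestronglyMeasurable).trans (le_of_eq ?_)
    rw [← hXint]
    congr 1
    ext z
    by_cases h : z ∈ C <;> simp [hX, h]
  have hvar : Var[Y; μ] ≤ (P C).toReal / n := by
    rw [hY, variance_const_mul, hμ, variance_sum_pi (μ := fun _ : Fin n => P) (X := fun _ => X)
      fun _ => hX2]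
    simp only [Finset.sum_const, Finset.card_univ, Fintype.card_fin, nsmul_eq_mul]
    calc ((n : ℝ)⁻¹) ^ 2 * (n * Var[X; P]) ≤ ((n : ℝ)⁻¹) ^ 2 * (n * (P C).toReal) := by gcongr
      _ = (P C).toReal / n := by field_simp
  have hYeq : ∀ x : Fin n → Z, (empirical x C).toReal = Y x := fun x => by
    rw [toReal_empirical_apply x hC]
    simp [hY, hX]
  simp only [hYeq]
  rw [← hmean, ← ofReal_integral_eq_lintegral_ofReal
    (show Integrable (fun x => (Y x - ∫ x, Y x ∂μ) ^ 2) μ from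
      (hYmem.sub (memLp_const _)).integrable_sq) (ae_of_all _ fun x => sq_nonneg _),
    ← variance_eq_integral hYmem.aemeasurable]
  refine (ENNReal.ofReal_le_ofReal hvar).trans (le_of_eq ?_)
  rw [ENNReal.ofReal_div_of_pos (by positivity), ENNReal.ofReal_toReal (measure_ne_top _ _),
    ENNReal.ofReal_natCast]

theorem measurable_empirical_apply {n : ℕ} {C : Set Z} (hC : MeasurableSet C) :
    Measurable fun x : Fin n → Z => empirical x C := by
  simp only [empirical, Measure.smul_apply, Measure.finsetSum_apply, smul_eq_mul,
    Measure.dirac_apply' _ hC]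
  refine Measurable.const_mul ?_ _
  exact Finset.measurable_fun_sum _ fun i _ =>
    (measurable_one.indicator hC).comp (measurable_pi_apply i)

theorem measurable_absDiff_empirical (P : Measure Z) {n : ℕ} {C : Set Z} (hC : MeasurableSet C) :
    Measurable fun x : Fin n → Z => absDiff (P C) (empirical x C) :=
  (measurable_const.sub (measurable_empirical_apply hC)).add
    ((measurable_empirical_apply hC).sub measurable_const)

theorem lintegral_absDiff_empirical_le (P : Measure Z) [IsProbabilityMeasure P] {n : ℕ}
    (hn : 1 ≤ n) {C : Set Z} (hC : MeasurableSet C) {t : ℝ} (ht : 0 < t) :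
    ∫⁻ x, absDiff (P C) (empirical x C) ∂(Measure.pi fun _ : Fin n => P) ≤
      ENNReal.ofReal t * (P C / n) + ENNReal.ofReal t⁻¹ := by
  have hfin : ∀ x : Fin n → Z, empirical x C ≠ ∞ := fun x => by
    have := isProbabilityMeasure_empirical hn x
    exact measure_ne_top _ _
  calc ∫⁻ x, absDiff (P C) (empirical x C) ∂(Measure.pi fun _ : Fin n => P)
      ≤ ∫⁻ x, (ENNReal.ofReal t * ENNReal.ofReal (((empirical x C).toReal - (P C).toReal) ^ 2)
          + ENNReal.ofReal t⁻¹) ∂(Measure.pi fun _ : Fin n => P) := by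
        refine lintegral_mono fun x => ?_
        rw [← ENNReal.ofReal_mul ht.le]
        exact absDiff_le_ofReal (measure_ne_top _ _) (hfin x) ht
    _ = ENNReal.ofReal t * ∫⁻ x, ENNReal.ofReal (((empirical x C).toReal - (P C).toReal) ^ 2)
          ∂(Measure.pi fun _ : Fin n => P) + ENNReal.ofReal t⁻¹ := by
        rw [lintegral_add_right _ measurable_const, lintegral_const_mul']
        · simp
        · exact ENNReal.ofReal_ne_top
    _ ≤ _ := by
        gcongr
        exact lintegral_sq_empirical_sub_le P hn hC

/-- Expected weighted discrepancy between the cell masses of `P` and of its empirical measure. -/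
theorem lintegral_tsum_absDiff_le {I : Type*} [MeasurableSpace I] [Countable I]
    [MeasurableSingletonClass I] (P : Measure Z) [IsProbabilityMeasure P] {n : ℕ} (hn : 1 ≤ n)
    {k : Z → I} (hk : Measurable k) (u : I → ℝ≥0∞) {w : I → ℝ} (hw : ∀ q, 0 < w q)
    {τ : ℝ} (hτ : 0 < τ) :
    ∫⁻ x, ∑' q, u q * absDiff (P (k ⁻¹' {q})) (empirical x (k ⁻¹' {q}))
        ∂(Measure.pi fun _ : Fin n => P) ≤
      ENNReal.ofReal (√n)⁻¹ * (ENNReal.ofReal τ * ∫⁻ z, u (k z) * ENNReal.ofReal (w (k z)) ∂P +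
        ENNReal.ofReal τ⁻¹ * ∑' q, u q * ENNReal.ofReal (w q)⁻¹) := by
  have hC : ∀ q, MeasurableSet (k ⁻¹' {q}) := fun q => hk (measurableSet_singleton q)
  have hm : ∀ q, Measurable fun x : Fin n → Z =>
      absDiff (P (k ⁻¹' {q})) (empirical x (k ⁻¹' {q})) := fun q =>
    measurable_absDiff_empirical P (hC q)
  have hsn : 0 < √(n : ℝ) := Real.sqrt_pos.2 (by exact_mod_cast hn)
  rw [lintegral_tsum fun q => ((hm q).const_mul _).aemeasurable]
  have hint : ∫⁻ z, u (k z) * ENNReal.ofReal (w (k z)) ∂P =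
      ∑' q, u q * ENNReal.ofReal (w q) * P (k ⁻¹' {q}) := by
    rw [← lintegral_map (f := fun q => u q * ENNReal.ofReal (w q))
      (measurable_of_countable _) hk, lintegral_countable']
    simp only [Measure.map_apply hk (measurableSet_singleton _)]
  rw [hint, ← ENNReal.tsum_mul_left, ← ENNReal.tsum_mul_left, ← ENNReal.tsum_add,
    ← ENNReal.tsum_mul_left]
  refine ENNReal.tsum_le_tsum fun q => ?_
  rw [lintegral_const_mul _ (hm q)]
  -- Young's parameter for the cell `q`: the factor `√n` makes both resulting terms of order `1 /
  -- √n`.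
  have ht : 0 < √(n : ℝ) * (τ * w q) := mul_pos hsn (mul_pos hτ (hw q))
  refine (mul_le_mul_right (lintegral_absDiff_empirical_le P hn (hC q) ht) _).trans
    (le_of_eq ?_)
  have e1 : ENNReal.ofReal (√(n : ℝ) * (τ * w q)) * (P (k ⁻¹' {q}) / n) =
      ENNReal.ofReal (√n)⁻¹ * (ENNReal.ofReal τ * ENNReal.ofReal (w q) * P (k ⁻¹' {q})) := by
    have h1 : (P (k ⁻¹' {q}) / n) = ENNReal.ofReal ((n : ℝ)⁻¹) * P (k ⁻¹' {q}) := by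
      rw [ENNReal.ofReal_inv_of_pos (by positivity), ENNReal.ofReal_natCast, div_eq_mul_inv,
        mul_comm]
    rw [h1, ← mul_assoc (ENNReal.ofReal (√(n : ℝ) * (τ * w q))), ← ENNReal.ofReal_mul ht.le,
      ← ENNReal.ofReal_mul hτ.le, ← mul_assoc (ENNReal.ofReal (√(n : ℝ))⁻¹),
      ← ENNReal.ofReal_mul (by positivity)]
    congr 2
    have h2 : (n : ℝ)⁻¹ = (√(n : ℝ))⁻¹ * (√(n : ℝ))⁻¹ := by
      rw [← mul_inv, Real.mul_self_sqrt (by positivity)]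
    rw [h2]
    field_simp
  have e2 : ENNReal.ofReal (√(n : ℝ) * (τ * w q))⁻¹ =
      ENNReal.ofReal (√n)⁻¹ * (ENNReal.ofReal τ⁻¹ * ENNReal.ofReal (w q)⁻¹) := by
    rw [← ENNReal.ofReal_mul (by positivity), ← ENNReal.ofReal_mul (by positivity), mul_inv,
      mul_inv]
  rw [e1, e2]
  ring

end EmpiricalMass

/-! ### Coordinates adapted to an arbitrary norm. -/

section Auerbach

theorem continuous_abs_basis_det {E : Type*} [NormedAddCommGroup E] [NormedSpace ℝ E]
    [FiniteDimensional ℝ E] {d : ℕ} (e : Module.Basis (Fin d) ℝ E) :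
    Continuous fun v : Fin d → E => |e.det v| := by
  have h : Continuous fun v : Fin d → E => (e.toMatrix v).det := by
    refine Continuous.matrix_det ?_
    refine continuous_matrix fun i j => ?_
    exact ((e.coord i).continuous_of_finiteDimensional).comp (continuous_apply j)
  simpa only [Module.Basis.det_apply] using h.abs

/-- Auerbach coordinates: every `d`-dimensional normed space has linear coordinates of norm at most
one which control the norm up to the factor `d`. -/
theorem exists_auerbach_coordinates {E : Type*} [NormedAddCommGroup E] [NormedSpace ℝ E]
    [FiniteDimensional ℝ E] {d : ℕ} (hd : Module.finrank ℝ E = d) :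
    ∃ T : E →ₗ[ℝ] (Fin d → ℝ), (∀ x, ‖T x‖ ≤ ‖x‖) ∧ ∀ x, ‖x‖ ≤ d * ‖T x‖ := by
  have : ProperSpace E := FiniteDimensional.proper ℝ E
  set e : Module.Basis (Fin d) ℝ E := Module.finBasisOfFinrankEq ℝ E hd
  set S : Set (Fin d → E) := Set.univ.pi fun _ => Metric.closedBall (0 : E) 1 with hS
  have hmem : ∀ v : Fin d → E, v ∈ S ↔ ∀ i, ‖v i‖ ≤ 1 := fun v => by simp [hS]
  have hScomp : IsCompact S := isCompact_univ_pi fun _ => isCompact_closedBall _ _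
  -- The Auerbach basis maximizes the absolute determinant over tuples of vectors in the unit ball.
  obtain ⟨v, hvS, hmax⟩ := hScomp.exists_isMaxOn ⟨fun _ => 0, (hmem _).2 fun _ => by simp⟩
    (continuous_abs_basis_det e).continuousOn
  have hv := (hmem v).1 hvS
  have hpos : 0 < |e.det v| := by
    have hne : ∀ i, ‖e i‖ ≠ 0 := fun i => norm_ne_zero_iff.2 (e.ne_zero i)
    set w : Fin d → E := fun i => (‖e i‖)⁻¹ • e i with hw
    have hwS : w ∈ S := (hmem w).2 fun i => by
      rw [hw, norm_smul, norm_inv, norm_norm, inv_mul_cancel₀ (hne i)]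
    refine lt_of_lt_of_le ?_ (hmax hwS)
    change 0 < |e.det w|
    have : e.det w = (∏ i, (‖e i‖)⁻¹) • e.det e := e.det.map_smul_univ _ _
    rw [this, e.det_self, abs_pos, smul_eq_mul, mul_one]
    exact Finset.prod_ne_zero_iff.2 fun i _ => inv_ne_zero (hne i)
  have hunit : IsUnit (e.det v) := isUnit_iff_ne_zero.2 (abs_pos.1 hpos)
  obtain ⟨hli, hsp⟩ := (e.is_basis_iff_det).2 hunit
  set b := Module.Basis.mk hli hsp.ge with hb
  -- Cramer's rule: replacing `v i` by `x` multiplies the determinant by the coordinate of `x`,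
  -- which by maximality has modulus at most one.
  have hcoord : ∀ x, ‖x‖ ≤ 1 → ∀ i, |b.coord i x| ≤ 1 := fun x hx i => by
    have h1 := LinearMap.congr_fun (e.det_smul_mk_coord_eq_det_update hli hsp.ge i) x
    have h2 : |e.det v * b.coord i x| ≤ |e.det v| := by
      have h3 : e.det v * b.coord i x = e.det (Function.update v i x) := h1
      rw [h3]
      refine hmax ((hmem _).2 fun j => ?_)
      rcases eq_or_ne j i with rfl | hj
      · simpa using hx
      · simpa [Function.update_of_ne hj] using hv j
    rw [abs_mul] at h2
    exact le_of_mul_le_mul_left (by simpa using h2) hpos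
  refine ⟨b.equivFun.toLinearMap, fun x => ?_, fun x => ?_⟩
  · rcases eq_or_ne x 0 with rfl | hx
    · simp
    · have hx0 : 0 < ‖x‖ := norm_pos_iff.2 hx
      refine (pi_norm_le_iff_of_nonneg (norm_nonneg x)).2 fun i => ?_
      have := hcoord (‖x‖⁻¹ • x) (by rw [norm_smul, norm_inv, norm_norm, inv_mul_cancel₀ hx0.ne']) i
      rw [map_smul, smul_eq_mul, abs_mul, abs_inv, abs_norm, inv_mul_le_iff₀ hx0, mul_one] at this
      simpa using this
  · have hx : ∑ i, b.equivFun x i • v i = x := by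
      conv_rhs => rw [← b.sum_equivFun x]
      simp [hb]
    calc ‖x‖ = ‖∑ i, b.equivFun x i • v i‖ := by rw [hx]
      _ ≤ ∑ i, ‖b.equivFun x i • v i‖ := norm_sum_le _ _
      _ ≤ ∑ _i : Fin d, ‖b.equivFun x‖ := Finset.sum_le_sum fun i _ => by
          rw [norm_smul]
          exact (mul_le_of_le_one_right (norm_nonneg _) (hv i)).trans (norm_le_pi_norm _ i)
      _ = d * ‖b.equivFun x‖ := by simp

end Auerbach

/-! ### Sums over the integer lattice. -/

section Lattice

theorem tsum_pi_prod_eq (φ : ℤ → ℝ≥0∞) (d : ℕ) :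
    ∑' q : Fin d → ℤ, ∏ i, φ (q i) = (∑' m, φ m) ^ d := by
  induction d with
  | zero => simp
  | succ d ih =>
    rw [← (Fin.consEquiv fun _ : Fin (d + 1) => ℤ).tsum_eq, ENNReal.tsum_prod']
    simp only [Fin.consEquiv_apply, Fin.prod_univ_succ, Fin.cons_zero, Fin.cons_succ,
      ENNReal.tsum_mul_left, ih, ENNReal.tsum_mul_right]
    ring

theorem tsum_int_inv_one_add_sq_ne_top : ∑' m : ℤ, ENNReal.ofReal (1 + (m : ℝ) ^ 2)⁻¹ ≠ ∞ := by
  have hs : Summable fun m : ℤ => (1 + (m : ℝ) ^ 2)⁻¹ := by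
    have h2 : Summable fun m : ℤ => 1 / (m : ℝ) ^ 2 :=
      Real.summable_one_div_int_pow.2 one_lt_two
    have h3 : Summable fun m : ℤ => if m = 0 then (1 : ℝ) else 0 :=
      (hasSum_ite_eq (0 : ℤ) (1 : ℝ)).summable
    refine (h2.add h3).of_nonneg_of_le (fun m => by positivity) fun m => ?_
    rcases eq_or_ne m 0 with rfl | hm
    · simp
    · have : (0 : ℝ) < (m : ℝ) ^ 2 := by positivity
      simp only [hm, if_false, add_zero, one_div]
      gcongr
      linarith
  rw [← ENNReal.ofReal_tsum_of_nonneg (fun m => by positivity) hs]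
  exact ENNReal.ofReal_ne_top

/-- The inverse powers `(1 + ‖q‖) ^ (-2 d)` are summable over the lattice `ℤ ^ d`. -/
theorem tsum_lattice_ne_top (d : ℕ) :
    ∑' q : Fin d → ℤ, ENNReal.ofReal ((1 + ‖q‖) ^ (2 * d))⁻¹ ≠ ∞ := by
  -- Each factor `1 + q i ^ 2` is at most `(1 + ‖q‖) ^ 2`, so the sum is dominated by a product of
  -- one-dimensional sums.
  refine ne_top_of_le_ne_top ?_ (b := ∑' q : Fin d → ℤ,
    ∏ i, ENNReal.ofReal (1 + (q i : ℝ) ^ 2)⁻¹) (ENNReal.tsum_le_tsum fun q => ?_)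
  · rw [tsum_pi_prod_eq fun m => ENNReal.ofReal (1 + (m : ℝ) ^ 2)⁻¹]
    exact ENNReal.pow_ne_top tsum_int_inv_one_add_sq_ne_top
  · rw [← ENNReal.ofReal_prod_of_nonneg fun i _ => by positivity]
    refine ENNReal.ofReal_le_ofReal ?_
    rw [Finset.prod_inv_distrib]
    refine inv_anti₀ (Finset.prod_pos fun i _ => by positivity) ?_
    calc ∏ i, (1 + (q i : ℝ) ^ 2) ≤ ∏ _i : Fin d, (1 + ‖q‖) ^ 2 := by
          refine Finset.prod_le_prod (fun i _ => by positivity) fun i _ => ?_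
          have h1 : |(q i : ℝ)| ≤ ‖q‖ := by simpa [Int.norm_eq_abs] using norm_le_pi_norm q i
          have h2 := norm_nonneg q
          have h3 : (q i : ℝ) ^ 2 ≤ ‖q‖ ^ 2 := by
            rw [← sq_abs]; gcongr
          nlinarith
      _ = (1 + ‖q‖) ^ (2 * d) := by simp [pow_mul]

/-- Every cube of side `N` contains `N ^ d` lattice points. -/
theorem tsum_div_lattice (d N : ℕ) [NeZero N] (φ : (Fin d → ℤ) → ℝ≥0∞) :
    ∑' q : Fin d → ℤ, φ (fun i => q i / N) = (N : ℝ≥0∞) ^ d * ∑' q, φ q := by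
  let e : (Fin d → ℤ) ≃ (Fin d → ℤ) × (Fin d → Fin N) :=
    (Equiv.arrowCongr (Equiv.refl _) (Int.divModEquiv N)).trans
      (Equiv.arrowProdEquivProdArrow (Fin d) (fun _ => ℤ) (fun _ => Fin N))
  have h : ∀ q, φ (fun i => q i / N) = (fun p : (Fin d → ℤ) × (Fin d → Fin N) => φ p.1) (e q) :=
    fun q => rfl
  simp only [h]
  rw [e.tsum_eq (fun p : (Fin d → ℤ) × (Fin d → Fin N) => φ p.1), ENNReal.tsum_prod',
    ← ENNReal.tsum_mul_left]
  refine tsum_congr fun q => ?_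
  simp

end Lattice

/-! ### Dyadic floors: nesting and size. -/

section Cells

theorem floor_two_pow_mul_eq {i j : ℕ} (hij : i ≤ j) (x : ℝ) :
    ⌊(2 : ℝ) ^ i * x⌋ = ⌊(2 : ℝ) ^ j * x⌋ / ((2 ^ (j - i) : ℕ) : ℤ) := by
  rw [← Int.floor_div_natCast]
  congr 1
  have : (2 : ℝ) ^ j = 2 ^ (j - i) * 2 ^ i := by rw [← pow_add, Nat.sub_add_cancel hij]
  rw [this]
  push_cast
  field_simp

theorem norm_sub_le_of_floor_eq {d : ℕ} (j : ℕ) {x y : Fin d → ℝ}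
    (h : ∀ i, ⌊(2 : ℝ) ^ j * x i⌋ = ⌊(2 : ℝ) ^ j * y i⌋) : ‖x - y‖ ≤ (2⁻¹ : ℝ) ^ j := by
  refine (pi_norm_le_iff_of_nonneg (by positivity)).2 fun i => ?_
  have h1 := (Int.abs_sub_lt_one_of_floor_eq_floor (h i)).le
  rw [← mul_sub, abs_mul, abs_of_pos (by positivity : (0 : ℝ) < 2 ^ j)] at h1
  rw [Pi.sub_apply, Real.norm_eq_abs, inv_pow, ← one_div, le_div_iff₀ (by positivity), mul_comm]
  exact h1

theorem norm_floor_sub_le {d : ℕ} (x : Fin d → ℝ) :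
    ‖x‖ ≤ ‖fun i => ⌊x i⌋‖ + 1 ∧ ‖fun i => ⌊x i⌋‖ ≤ ‖x‖ + 1 := by
  constructor
  · refine (pi_norm_le_iff_of_nonneg (by positivity)).2 fun i => ?_
    have h1 : |(⌊x i⌋ : ℝ)| ≤ ‖fun i => ⌊x i⌋‖ := by
      simpa [Int.norm_eq_abs] using norm_le_pi_norm (fun i => ⌊x i⌋) i
    have h2 := Int.floor_le (x i)
    have h3 := Int.lt_floor_add_one (x i)
    rw [Real.norm_eq_abs, abs_le]
    have := abs_le.1 h1
    constructor <;> linarith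
  · refine (pi_norm_le_iff_of_nonneg (by positivity)).2 fun i => ?_
    have h1 : |x i| ≤ ‖x‖ := norm_le_pi_norm x i
    have h2 := Int.floor_le (x i)
    have h3 := Int.lt_floor_add_one (x i)
    rw [Int.norm_eq_abs, abs_le]
    have := abs_le.1 h1
    constructor <;> linarith

end Cells

/-! ### Choice of depth and summation over scales. -/

section Rate

/-- Take `L` to be the integer logarithm of `n` in base `2 ^ D`, so that `2 ^ (D L) ≤ n < 2 ^ (D (L
+ 1))`. -/
theorem exists_depth {D : ℕ} (hD : 1 ≤ D) {n : ℕ} (hn : 1 ≤ n) :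
    ∃ L : ℕ, (2 : ℝ) ^ L ≤ (n : ℝ) ^ ((1 : ℝ) / D) ∧
      (2⁻¹ : ℝ) ^ L ≤ 2 * (n : ℝ) ^ (-((1 : ℝ) / D)) := by
  have hn0 : (0 : ℝ) < n := by exact_mod_cast hn
  have hroot : ∀ L : ℕ, (((2 : ℝ) ^ D) ^ L) ^ ((1 : ℝ) / D) = 2 ^ L := fun L => by
    rw [pow_right_comm, one_div, Real.pow_rpow_inv_natCast (by positivity) (by omega)]
  refine ⟨Nat.log (2 ^ D) n, ?_, ?_⟩
  · rw [← hroot]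
    refine Real.rpow_le_rpow (by positivity) ?_ (by positivity)
    exact_mod_cast Nat.pow_log_le_self (2 ^ D) (by omega)
  · have h : (n : ℝ) ^ ((1 : ℝ) / D) ≤ 2 ^ (Nat.log (2 ^ D) n + 1) := by
      rw [← hroot]
      refine Real.rpow_le_rpow (by positivity) ?_ (by positivity)
      exact_mod_cast (Nat.lt_pow_succ_log_self (Nat.one_lt_two_pow (by omega)) n).le
    rw [Real.rpow_neg hn0.le, inv_pow, ← div_eq_mul_inv, le_div_iff₀ (by positivity),
      inv_mul_le_iff₀ (by positivity)]
    rw [pow_succ] at h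
    exact h

/-- With the resolution `2 ^ L ≈ n ^ (1 / max d 2)` the sum of the fluctuations over all scales has
the rate `n ^ (-1 / max d 2)`. In dimension two there would be an additional logarithm. -/
theorem exists_depth_sum_le {d : ℕ} (hd : d ≠ 2) :
    ∃ C : ℝ, 0 ≤ C ∧ ∀ n : ℕ, 1 ≤ n → ∃ L : ℕ,
      (2⁻¹ : ℝ) ^ L ≤ 2 * (n : ℝ) ^ (-((1 : ℝ) / (max d 2 : ℕ))) ∧
      (√(n : ℝ))⁻¹ ≤ (n : ℝ) ^ (-((1 : ℝ) / (max d 2 : ℕ))) ∧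
      (√(n : ℝ))⁻¹ * ∑ j ∈ Finset.range L, (√2 ^ d / 2) ^ (j + 1) ≤
        C * (n : ℝ) ^ (-((1 : ℝ) / (max d 2 : ℕ))) := by
  have hs2 : √(2 : ℝ) ^ 2 = 2 := Real.sq_sqrt (by norm_num)
  have hs1 : 1 < √(2 : ℝ) := Real.one_lt_sqrt_two
  set β : ℝ := √2 ^ d / 2 with hβ
  have hβ0 : 0 < β := by positivity
  have hsqrt : ∀ n : ℕ, (√(n : ℝ))⁻¹ = (n : ℝ) ^ (-((1 : ℝ) / 2)) := fun n => by
    rw [Real.sqrt_eq_rpow, Real.rpow_neg (by positivity)]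
  have hrate : ∀ n : ℕ, 1 ≤ n → (√(n : ℝ))⁻¹ ≤ (n : ℝ) ^ (-((1 : ℝ) / (max d 2 : ℕ))) := by
    intro n hn
    rw [hsqrt]
    refine Real.rpow_le_rpow_of_exponent_le (by exact_mod_cast hn) (neg_le_neg ?_)
    refine one_div_le_one_div_of_le two_pos ?_
    exact_mod_cast le_max_right d 2
  rcases lt_or_gt_of_ne hd with h | h
  -- For `d < 2` the series over scales converges, and the term `n ^ (-1/2)` dominates.
  · have hβ1 : β < 1 := by
      have : √(2 : ℝ) ^ d ≤ √2 ^ 1 := pow_le_pow_right₀ hs1.le (by omega)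
      rw [hβ, div_lt_one two_pos]
      nlinarith
    refine ⟨(1 - β)⁻¹, by rw [inv_nonneg]; linarith, fun n hn => ?_⟩
    obtain ⟨L, -, hL⟩ := exists_depth (D := max d 2) (by omega) hn
    refine ⟨L, hL, hrate n hn, ?_⟩
    have hsum : ∑ j ∈ Finset.range L, β ^ (j + 1) ≤ (1 - β)⁻¹ := by
      rw [← tsum_geometric_of_lt_one hβ0.le hβ1]
      refine le_trans (Finset.sum_le_sum fun j _ => ?_)
        ((summable_geometric_of_lt_one hβ0.le hβ1).sum_le_tsum _ fun j _ => by positivity)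
      exact pow_le_pow_of_le_one hβ0.le hβ1.le (Nat.le_succ j)
    rw [mul_comm]
    have := hrate n hn
    gcongr
  -- For `d > 2` the finest scale dominates: `β ^ L = (2 ^ L) ^ (d/2 - 1) ≤ n ^ (1/2 - 1/d)`, and
  -- the factor `n ^ (-1/2)` leaves `n ^ (-1/d)`.
  · have hmax : max d 2 = d := by omega
    have hβ1 : 1 < β := by
      have : √(2 : ℝ) ^ 3 ≤ √2 ^ d := pow_le_pow_right₀ hs1.le (by omega)
      rw [hβ, one_lt_div two_pos]
      nlinarith
    refine ⟨β / (β - 1), div_nonneg hβ0.le (by linarith), fun n hn => ?_⟩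
    have hn0 : (0 : ℝ) < n := by exact_mod_cast hn
    obtain ⟨L, hL', hL⟩ := exists_depth (D := max d 2) (by omega) hn
    refine ⟨L, hL, hrate n hn, ?_⟩
    have hsum : ∑ j ∈ Finset.range L, β ^ (j + 1) ≤ β / (β - 1) * β ^ L := by
      simp only [pow_succ]
      rw [← Finset.sum_mul, geom_sum_eq hβ1.ne']
      calc (β ^ L - 1) / (β - 1) * β = β / (β - 1) * (β ^ L - 1) := by ring
        _ ≤ β / (β - 1) * β ^ L :=
          mul_le_mul_of_nonneg_left (by linarith) (div_nonneg hβ0.le (by linarith))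
    have hβL : β ^ L ≤ (n : ℝ) ^ ((1 : ℝ) / 2 - 1 / d) := by
      have hd0 : (d : ℝ) ≠ 0 := by positivity
      have hβe : β = (2 : ℝ) ^ ((d : ℝ) / 2 - 1) := by
        rw [hβ, Real.sqrt_eq_rpow, ← Real.rpow_mul_natCast two_pos.le, Real.rpow_sub two_pos,
          Real.rpow_one]
        congr 2
        ring
      have hexp : (0 : ℝ) ≤ (d : ℝ) / 2 - 1 := by
        have : (2 : ℝ) ≤ d := by exact_mod_cast h.le
        linarith
      calc β ^ L = ((2 : ℝ) ^ L) ^ ((d : ℝ) / 2 - 1) := by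
            rw [hβe, ← Real.rpow_mul_natCast two_pos.le, ← Real.rpow_natCast_mul two_pos.le,
              mul_comm]
        _ ≤ ((n : ℝ) ^ ((1 : ℝ) / (max d 2 : ℕ))) ^ ((d : ℝ) / 2 - 1) :=
            Real.rpow_le_rpow (by positivity) hL' hexp
        _ = (n : ℝ) ^ ((1 : ℝ) / 2 - 1 / d) := by
            rw [hmax, ← Real.rpow_mul hn0.le]
            congr 1
            field_simp
    calc (√(n : ℝ))⁻¹ * ∑ j ∈ Finset.range L, β ^ (j + 1)
        ≤ (√(n : ℝ))⁻¹ * (β / (β - 1) * (n : ℝ) ^ ((1 : ℝ) / 2 - 1 / d)) := by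
          refine mul_le_mul_of_nonneg_left (hsum.trans ?_) (by positivity)
          exact mul_le_mul_of_nonneg_left hβL (div_nonneg hβ0.le (by linarith))
      _ = β / (β - 1) * (n : ℝ) ^ (-((1 : ℝ) / (max d 2 : ℕ))) := by
          rw [hsqrt, mul_left_comm, ← Real.rpow_add hn0, hmax]
          congr 2
          ring

end Rate

/-! ### Consequences of an exponential moment bound. -/

section Mean

theorem pow_le_factorial_mul_exp (p : ℕ) {x : ℝ} (hx : 0 ≤ x) :
    (2 + x) ^ p ≤ p.factorial * Real.exp 2 * Real.exp x := by
  have h := Real.pow_div_factorial_le_exp (x := 2 + x) (by positivity) p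
  rw [div_le_iff₀ (by positivity), Real.exp_add] at h
  linarith

/-- Some point does not exceed the average. It serves as the root of the tree, so that the root's
norm is controlled by `B` alone. -/
theorem exists_norm_le_of_lintegral_exp_le {E : Type*} [NormedAddCommGroup E]
    [MeasurableSpace E] [OpensMeasurableSpace E] {Z : Set E} {P : Measure Z} [IsProbabilityMeasure P] {B : ℝ}
    (hB : ∫⁻ z : Z, ENNReal.ofReal (Real.exp ‖(z : E)‖) ∂P ≤ ENNReal.ofReal B) :
    ∃ z₀ : Z, Real.exp ‖(z₀ : E)‖ ≤ B := by
  have hm : Measurable fun z : Z => ENNReal.ofReal (Real.exp ‖(z : E)‖) :=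
    (Real.measurable_exp.comp (measurable_norm.comp measurable_subtype_coe)).ennreal_ofReal
  obtain ⟨z₀, hz₀⟩ := exists_le_lintegral (μ := P) hm.aemeasurable
  refine ⟨z₀, ?_⟩
  rcases ENNReal.ofReal_le_ofReal_iff'.1 (hz₀.trans hB) with h | h
  · exact h
  · exact absurd h (Real.exp_pos _).not_ge

theorem lintegral_pow_le {E : Type*} [NormedAddCommGroup E]
    [MeasurableSpace E] {Z : Set E} {P : Measure Z} {B : ℝ}
    (hB : ∫⁻ z : Z, ENNReal.ofReal (Real.exp ‖(z : E)‖) ∂P ≤ ENNReal.ofReal B) (p : ℕ) :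
    ∫⁻ z : Z, ENNReal.ofReal ((2 + ‖(z : E)‖) ^ p) ∂P ≤
      ENNReal.ofReal (p.factorial * Real.exp 2 * B) := by
  rw [ENNReal.ofReal_mul (by positivity)]
  refine le_trans ?_ (mul_le_mul_right hB _)
  rw [← lintegral_const_mul' _ _ ENNReal.ofReal_ne_top]
  refine lintegral_mono fun z => ?_
  rw [← ENNReal.ofReal_mul (by positivity)]
  exact ENNReal.ofReal_le_ofReal (pow_le_factorial_mul_exp p (norm_nonneg _))

end Mean

/-! ### The mean Wasserstein distance to the empirical measure. -/

section MeanBound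

/-- The dyadic cell of side `2 ^ (-j)` containing a point, in the coordinates `T`. -/
noncomputable def cellIndex {X : Type*} {d : ℕ} (T : X → Fin d → ℝ) (j : ℕ) (x : X) : Fin d → ℤ :=
  fun i => ⌊(2 : ℝ) ^ j * T x i⌋

theorem cellIndex_eq_div {X : Type*} {d : ℕ} (T : X → Fin d → ℝ) {i j : ℕ} (hij : i ≤ j) (x : X) :
    cellIndex T i x = fun l => cellIndex T j x l / ((2 ^ (j - i) : ℕ) : ℤ) :=
  funext fun l => floor_two_pow_mul_eq hij (T x l)

theorem cellIndex_zero {X : Type*} {d : ℕ} (T : X → Fin d → ℝ) (x : X) :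
    cellIndex T 0 x = fun i => ⌊T x i⌋ := by
  ext i; simp [cellIndex]

open Classical in
/-- A chosen point of a dyadic cell, with the value `x₀` if the cell is empty. -/
noncomputable def cellPoint {X : Type*} {d : ℕ} (T : X → Fin d → ℝ) (x₀ : X) (j : ℕ)
    (q : Fin d → ℤ) : X :=
  if h : ∃ x, cellIndex T j x = q then h.choose else x₀

theorem cellIndex_cellPoint {X : Type*} {d : ℕ} (T : X → Fin d → ℝ) (x₀ : X) {i j : ℕ}
    (hij : i ≤ j) (x : X) : cellIndex T i (cellPoint T x₀ j (cellIndex T j x)) = cellIndex T i x := by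
  have h : ∃ y, cellIndex T j y = cellIndex T j x := ⟨x, rfl⟩
  rw [cellIndex_eq_div T hij, cellIndex_eq_div T hij, cellPoint, dif_pos h, h.choose_spec]

variable {E : Type*} [NormedAddCommGroup E] [NormedSpace ℝ E] [FiniteDimensional ℝ E]
  [MeasurableSpace E] [BorelSpace E] {d : ℕ} {T : E →ₗ[ℝ] (Fin d → ℝ)} {Z : Set E}

theorem measurable_cellIndex (j : ℕ) : Measurable (cellIndex (fun z : Z => T z) j) := by
  refine measurable_pi_iff.2 fun i => Int.measurable_floor.comp (Measurable.const_mul ?_ _)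
  have h : Measurable fun z : Z => T z :=
    (T.continuous_of_finiteDimensional).measurable.comp measurable_subtype_coe
  exact (measurable_pi_apply i).comp h

omit [FiniteDimensional ℝ E] [MeasurableSpace E] [BorelSpace E] in
theorem edist_le_of_cellIndex_eq (hT : ∀ x, ‖x‖ ≤ d * ‖T x‖) {j : ℕ} {y z : Z}
    (h : cellIndex (fun z : Z => T z) j y = cellIndex (fun z : Z => T z) j z) :
    edist y z ≤ ENNReal.ofReal (d * (2⁻¹ : ℝ) ^ j) := by
  rw [edist_dist, Subtype.dist_eq, dist_eq_norm]
  refine ENNReal.ofReal_le_ofReal ((hT _).trans ?_)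
  rw [map_sub]
  exact mul_le_mul_of_nonneg_left (norm_sub_le_of_floor_eq j fun i => congrFun h i) (by positivity)

omit [FiniteDimensional ℝ E] [MeasurableSpace E] [BorelSpace E] in
theorem edist_cellPoint_zero_le (hT : ∀ x, ‖x‖ ≤ d * ‖T x‖) {z₀ : Z} {B : ℝ}
    (hz₀ : ‖(z₀ : E)‖ ≤ B) (z : Z) :
    edist (cellPoint (fun z : Z => T z) z₀ 0 (cellIndex (fun z : Z => T z) 0 z)) z₀ ≤
      ENNReal.ofReal ((d + B) * (1 + ‖cellIndex (fun z : Z => T z) 0 z‖)) := by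
  have hB : 0 ≤ B := (norm_nonneg _).trans hz₀
  set y := cellPoint (fun z : Z => T z) z₀ 0 (cellIndex (fun z : Z => T z) 0 z) with hy
  have h1 : cellIndex (fun z : Z => T z) 0 y = cellIndex (fun z : Z => T z) 0 z :=
    cellIndex_cellPoint _ z₀ le_rfl z
  rw [edist_dist, Subtype.dist_eq, dist_eq_norm]
  refine ENNReal.ofReal_le_ofReal ((norm_sub_le _ _).trans ?_)
  have h2 := (norm_floor_sub_le (T y)).1
  have h3 : (fun i => ⌊T y i⌋) = cellIndex (fun z : Z => T z) 0 z := by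
    rw [← h1, cellIndex_zero]
  rw [h3] at h2
  have h4 := hT y
  have h5 : (d : ℝ) * ‖T y‖ ≤ d * (‖cellIndex (fun z : Z => T z) 0 z‖ + 1) := by gcongr
  have h6 : 0 ≤ B * ‖cellIndex (fun z : Z => T z) 0 z‖ := by positivity
  nlinarith

omit [FiniteDimensional ℝ E] [MeasurableSpace E] [BorelSpace E] in
theorem one_add_norm_cellIndex_le (hT' : ∀ x, ‖T x‖ ≤ ‖x‖) (z : Z) :
    1 + ‖cellIndex (fun z : Z => T z) 0 z‖ ≤ 2 + ‖(z : E)‖ := by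
  have h := (norm_floor_sub_le (T z)).2
  rw [cellIndex_zero]
  have := hT' z
  linarith

/-- The constant bounding the sum over the lattice `ℤ ^ d` of `(1 + ‖q‖) ^ (-2 d)`. -/
noncomputable def latticeConst (d : ℕ) : ℝ :=
  (∑' q : Fin d → ℤ, ENNReal.ofReal ((1 + ‖q‖) ^ (2 * d))⁻¹).toReal

theorem ofReal_latticeConst (d : ℕ) : ENNReal.ofReal (latticeConst d) =
    ∑' q : Fin d → ℤ, ENNReal.ofReal ((1 + ‖q‖) ^ (2 * d))⁻¹ :=
  ENNReal.ofReal_toReal (tsum_lattice_ne_top d)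

/-- The constant bounding the moment of order `2 d + 2`. -/
noncomputable def momentConst (d : ℕ) (B : ℝ) : ℝ :=
  ((2 * d + 2).factorial : ℝ) * Real.exp 2 * B

/-- The displacement to the root grows like `1 + ‖q‖`. The weight `(1 + ‖q‖) ^ (2d + 1)` turns the
variance part into a moment of order `2d + 2` and the other part into the convergent lattice sum. -/
theorem lintegral_top_level_le (hT : ∀ x, ‖x‖ ≤ d * ‖T x‖) (hT' : ∀ x, ‖T x‖ ≤ ‖x‖)
    {z₀ : Z} {P : Measure Z} [IsProbabilityMeasure P] {B : ℝ} (hz₀ : ‖(z₀ : E)‖ ≤ B)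
    (hB : ∫⁻ z : Z, ENNReal.ofReal (Real.exp ‖(z : E)‖) ∂P ≤ ENNReal.ofReal B)
    {n : ℕ} (hn : 1 ≤ n) :
    ∫⁻ x, ∑' q, edist (cellPoint (fun z : Z => T z) z₀ 0 q) z₀ *
        absDiff (P (cellIndex (fun z : Z => T z) 0 ⁻¹' {q}))
          (empirical x (cellIndex (fun z : Z => T z) 0 ⁻¹' {q}))
        ∂(Measure.pi fun _ : Fin n => P) ≤
      ENNReal.ofReal ((√n)⁻¹ * ((d + B) * (momentConst d B + latticeConst d))) := by
  have hB0 : 0 ≤ B := (norm_nonneg _).trans hz₀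
  set k := cellIndex (fun z : Z => T z) 0 with hk
  have hkm : Measurable k := measurable_cellIndex 0
  have hM0 : 0 ≤ momentConst d B := by unfold momentConst; positivity
  have hL0 : 0 ≤ latticeConst d := ENNReal.toReal_nonneg
  have hle : ∀ (x : Fin n → Z) q, edist (cellPoint (fun z : Z => T z) z₀ 0 q) z₀ *
      absDiff (P (k ⁻¹' {q})) (empirical x (k ⁻¹' {q})) ≤
      ENNReal.ofReal ((d + B) * (1 + ‖q‖)) *
        absDiff (P (k ⁻¹' {q})) (empirical x (k ⁻¹' {q})) := by
    intro x q
    by_cases h : ∃ z, k z = q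
    · obtain ⟨z, rfl⟩ := h
      gcongr
      exact edist_cellPoint_zero_le hT hz₀ z
    · have : k ⁻¹' {q} = ∅ := by
        ext z
        simp only [Set.mem_preimage, Set.mem_singleton_iff, Set.mem_empty_iff_false, iff_false]
        exact fun hz => h ⟨z, hz⟩
      simp [this, absDiff]
  refine (lintegral_mono fun x => ENNReal.tsum_le_tsum (hle x)).trans ?_
  refine (lintegral_tsum_absDiff_le P hn hkm _ (w := fun q => (1 + ‖q‖) ^ (2 * d + 1))
    (fun q => by positivity) one_pos).trans ?_
  rw [ENNReal.ofReal_mul (by positivity)]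
  gcongr
  rw [inv_one, ENNReal.ofReal_one, one_mul, one_mul, mul_add,
    ENNReal.ofReal_add (by positivity) (by positivity)]
  refine add_le_add ?_ (le_of_eq ?_)
  · rw [ENNReal.ofReal_mul (by positivity)]
    refine le_trans ?_ (mul_le_mul_right (lintegral_pow_le hB (2 * d + 2)) _)
    rw [← lintegral_const_mul' _ _ ENNReal.ofReal_ne_top]
    refine lintegral_mono fun z => ?_
    rw [← ENNReal.ofReal_mul (by positivity), ← ENNReal.ofReal_mul (by positivity)]
    refine ENNReal.ofReal_le_ofReal ?_
    rw [mul_assoc, ← pow_succ']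
    have := one_add_norm_cellIndex_le hT' z
    gcongr
  · rw [ENNReal.ofReal_mul (by positivity), ofReal_latticeConst, ← ENNReal.tsum_mul_left]
    refine tsum_congr fun q => ?_
    rw [← ENNReal.ofReal_mul (by positivity), ← ENNReal.ofReal_mul (by positivity)]
    congr 1
    have : (1 + ‖q‖) ≠ 0 := by positivity
    field_simp
    ring

/-- Moves have length at most `d * 2 ^ (-j)`. The weight depends only on the unit cube containing
the cell, so the lattice sum gains just the factor `2 ^ ((j + 1) d)` counting subcells. -/
theorem lintegral_level_le (hT : ∀ x, ‖x‖ ≤ d * ‖T x‖) (hT' : ∀ x, ‖T x‖ ≤ ‖x‖)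
    {z₀ : Z} {P : Measure Z} [IsProbabilityMeasure P] {B : ℝ} (hB0 : 0 ≤ B)
    (hB : ∫⁻ z : Z, ENNReal.ofReal (Real.exp ‖(z : E)‖) ∂P ≤ ENNReal.ofReal B)
    {n : ℕ} (hn : 1 ≤ n) (j : ℕ) :
    ∫⁻ x, ∑' q, edist (cellPoint (fun z : Z => T z) z₀ (j + 1) q)
        (cellPoint (fun z : Z => T z) z₀ j (cellIndex (fun z : Z => T z) j
          (cellPoint (fun z : Z => T z) z₀ (j + 1) q))) *
        absDiff (P (cellIndex (fun z : Z => T z) (j + 1) ⁻¹' {q}))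
          (empirical x (cellIndex (fun z : Z => T z) (j + 1) ⁻¹' {q}))
        ∂(Measure.pi fun _ : Fin n => P) ≤
      ENNReal.ofReal ((√n)⁻¹ *
        (2 * d * (momentConst d B + latticeConst d) * (√2 ^ d / 2) ^ (j + 1))) := by
  set k := cellIndex (fun z : Z => T z) (j + 1) with hk
  have hkm : Measurable k := measurable_cellIndex (j + 1)
  have hM0 : 0 ≤ momentConst d B := by unfold momentConst; positivity
  have hL0 : 0 ≤ latticeConst d := ENNReal.toReal_nonneg
  have hs2 : √(2 : ℝ) * √2 = 2 := Real.mul_self_sqrt (by norm_num)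
  -- The square root of the number of subcells: it balances `τ` times the moment against `τ⁻¹ * 2 ^
  -- ((j + 1) d)` times the lattice sum.
  set τ : ℝ := (√2 ^ d) ^ (j + 1) with hτ
  have hτ0 : 0 < τ := by positivity
  have hle : ∀ (x : Fin n → Z) q, edist (cellPoint (fun z : Z => T z) z₀ (j + 1) q)
        (cellPoint (fun z : Z => T z) z₀ j (cellIndex (fun z : Z => T z) j
          (cellPoint (fun z : Z => T z) z₀ (j + 1) q))) *
      absDiff (P (k ⁻¹' {q})) (empirical x (k ⁻¹' {q})) ≤
      ENNReal.ofReal (d * (2⁻¹ : ℝ) ^ j) *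
        absDiff (P (k ⁻¹' {q})) (empirical x (k ⁻¹' {q})) := by
    intro x q
    gcongr
    exact edist_le_of_cellIndex_eq hT (cellIndex_cellPoint _ z₀ le_rfl _).symm
  refine (lintegral_mono fun x => ENNReal.tsum_le_tsum (hle x)).trans ?_
  set anc : (Fin d → ℤ) → (Fin d → ℤ) := fun q i => q i / ((2 ^ (j + 1) : ℕ) : ℤ) with hanc
  refine (lintegral_tsum_absDiff_le P hn hkm _ (w := fun q => (1 + ‖anc q‖) ^ (2 * d))
    (fun q => by positivity) hτ0).trans ?_
  have hanck : ∀ z, anc (k z) = cellIndex (fun z : Z => T z) 0 z := fun z => by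
    rw [cellIndex_eq_div _ (Nat.zero_le (j + 1))]
    rfl
  rw [ENNReal.ofReal_mul (p := (√(n : ℝ))⁻¹) (by positivity)]
  gcongr
  have hsplit : 2 * d * (momentConst d B + latticeConst d) * (√2 ^ d / 2) ^ (j + 1) =
      τ * (d * (2⁻¹ : ℝ) ^ j * momentConst d B) + τ * (d * (2⁻¹ : ℝ) ^ j * latticeConst d) := by
    rw [hτ, div_pow, inv_pow]
    field_simp
    ring
  rw [hsplit, ENNReal.ofReal_add (by positivity) (by positivity),
    ENNReal.ofReal_mul (p := τ) (by positivity), ENNReal.ofReal_mul (p := τ) (by positivity)]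
  refine add_le_add ?_ (le_of_eq ?_)
  · gcongr
    rw [lintegral_const_mul' _ _ ENNReal.ofReal_ne_top,
      ENNReal.ofReal_mul (p := d * (2⁻¹ : ℝ) ^ j) (by positivity)]
    gcongr
    refine le_trans (lintegral_mono fun z => ?_) (lintegral_pow_le hB (2 * d + 2))
    refine ENNReal.ofReal_le_ofReal ?_
    rw [hanck]
    have h1 := one_add_norm_cellIndex_le hT' z
    have h2 := norm_nonneg (z : E)
    calc (1 + ‖cellIndex (fun z : Z => T z) 0 z‖) ^ (2 * d) ≤ (2 + ‖(z : E)‖) ^ (2 * d) := by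
          gcongr
      _ ≤ (2 + ‖(z : E)‖) ^ (2 * d + 2) := pow_le_pow_right₀ (by linarith) (by omega)
  · rw [ENNReal.tsum_mul_left,
      tsum_div_lattice d (2 ^ (j + 1)) fun q => ENNReal.ofReal ((1 + ‖q‖) ^ (2 * d))⁻¹,
      ← ofReal_latticeConst]
    have hpow : ((2 ^ (j + 1) : ℕ) : ℝ≥0∞) ^ d = ENNReal.ofReal (τ * τ) := by
      have : τ * τ = (2 ^ (j + 1)) ^ d := by
        rw [hτ, ← mul_pow, ← mul_pow, hs2, ← pow_mul, ← pow_mul, mul_comm]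
      rw [this, ENNReal.ofReal_pow (by positivity), ENNReal.ofReal_pow (by positivity)]
      simp
    rw [hpow, ← ENNReal.ofReal_mul (by positivity), ← ENNReal.ofReal_mul (by positivity),
      ← ENNReal.ofReal_mul (by positivity), ← ENNReal.ofReal_mul (by positivity)]
    congr 1
    field_simp

/-- The expected Wasserstein distance between `P` and its empirical measure. -/
theorem exists_lintegral_W1_empirical_le {d : ℕ} (hd : d ≠ 2) (B : ℝ) :
    ∃ C : ℝ, 0 ≤ C ∧
      ∀ (E : Type*) [NormedAddCommGroup E] [NormedSpace ℝ E] [FiniteDimensional ℝ E]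
        [MeasurableSpace E] [BorelSpace E], Module.finrank ℝ E = d →
      ∀ (Z : Set E), MeasurableSet Z → ∀ (P : Measure Z) [IsProbabilityMeasure P],
        ∫⁻ z : Z, ENNReal.ofReal (Real.exp ‖(z : E)‖) ∂P ≤ ENNReal.ofReal B →
      ∀ n : ℕ, 1 ≤ n → ∫⁻ x, W1 P (empirical x) ∂(Measure.pi fun _ : Fin n => P) ≤
        ENNReal.ofReal (C * (n : ℝ) ^ (-((1 : ℝ) / (max d 2 : ℕ)))) := by
  obtain ⟨C₀, hC₀, hrate⟩ := exists_depth_sum_le hd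
  set B' := max B 0 with hB'
  have hB'0 : 0 ≤ B' := le_max_right _ _
  set G := momentConst d B' + latticeConst d with hG
  have hG0 : 0 ≤ G :=
    add_nonneg (by unfold momentConst; positivity) ENNReal.toReal_nonneg
  -- The three terms come from rounding at depth `L`, the intermediate scales, and the gathering at
  -- the root.
  refine ⟨4 * d + 2 * d * G * C₀ + (d + B') * G, by positivity, ?_⟩
  intro E _ _ _ _ _ hE Z hZ P _ hB n hn
  have : ProperSpace E := FiniteDimensional.proper ℝ E
  have : StandardBorelSpace Z := hZ.standardBorel
  obtain ⟨T, hT', hT⟩ := exists_auerbach_coordinates hE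
  obtain ⟨z₀, hz₀⟩ := exists_norm_le_of_lintegral_exp_le hB
  have hz₀B : ‖(z₀ : E)‖ ≤ B' :=
    (Real.add_one_le_exp _).trans' (by linarith) |>.trans hz₀ |>.trans (le_max_left _ _)
  have hBB : ∫⁻ z : Z, ENNReal.ofReal (Real.exp ‖(z : E)‖) ∂P ≤ ENNReal.ofReal B' :=
    hB.trans (ENNReal.ofReal_le_ofReal (le_max_left _ _))
  obtain ⟨L, hL₁, hL₂, hL₃⟩ := hrate n hn
  set R := (n : ℝ) ^ (-((1 : ℝ) / (max d 2 : ℕ))) with hR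
  have hk : ∀ j, Measurable (cellIndex (fun z : Z => T z) j) := measurable_cellIndex
  have hmeas : ∀ (j : ℕ) (u : (Fin d → ℤ) → ℝ≥0∞), Measurable fun x : Fin n → Z =>
      ∑' q, u q * absDiff (P (cellIndex (fun z : Z => T z) j ⁻¹' {q}))
        (empirical x (cellIndex (fun z : Z => T z) j ⁻¹' {q})) := fun j u =>
    Measurable.tsum fun q =>
      (measurable_absDiff_empirical P (hk j (measurableSet_singleton q))).const_mul _
  have hpt : ∀ x : Fin n → Z, W1 P (empirical x) ≤ _ := fun x => by
    have := isProbabilityMeasure_empirical hn x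
    exact W1_le_sum_cells hk (fun i j hij z => cellIndex_cellPoint _ z₀ hij z) z₀ L
      (r := ENNReal.ofReal (d * (2⁻¹ : ℝ) ^ L))
      (fun z => edist_le_of_cellIndex_eq hT (cellIndex_cellPoint _ z₀ le_rfl z).symm) P
      (empirical x)
  refine (lintegral_mono hpt).trans ?_
  rw [lintegral_add_left measurable_const, lintegral_add_right _ (hmeas 0 _),
    lintegral_finsetSum _ fun j _ => hmeas (j + 1) _]
  simp only [lintegral_const, measure_univ, mul_one]
  refine (add_le_add le_rfl (add_le_add (Finset.sum_le_sum fun j _ =>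
    lintegral_level_le hT hT' hB'0 hBB hn j) (lintegral_top_level_le hT hT' hz₀B hBB hn))).trans ?_
  rw [← ENNReal.ofReal_sum_of_nonneg fun j _ => by positivity,
    ← ENNReal.ofReal_add (Finset.sum_nonneg fun j _ => by positivity) (by positivity),
    show (2 : ℝ≥0∞) = ENNReal.ofReal 2 by simp, ← ENNReal.ofReal_mul two_pos.le,
    ← ENNReal.ofReal_add (by positivity)
      (add_nonneg (Finset.sum_nonneg fun j _ => by positivity) (by positivity))]
  refine ENNReal.ofReal_le_ofReal ?_
  rw [← Finset.mul_sum, ← Finset.mul_sum]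
  have h1 : 2 * (d * (2⁻¹ : ℝ) ^ L) ≤ 4 * d * R := by
    calc 2 * (d * (2⁻¹ : ℝ) ^ L) ≤ 2 * (d * (2 * R)) := by gcongr
      _ = 4 * d * R := by ring
  have h2 : (√(n : ℝ))⁻¹ * (2 * d * G * ∑ j ∈ Finset.range L, (√2 ^ d / 2) ^ (j + 1)) ≤
      2 * d * G * C₀ * R := by
    rw [mul_left_comm, mul_assoc (2 * d * G)]
    gcongr
  have h3 : (√(n : ℝ))⁻¹ * ((d + B') * G) ≤ (d + B') * G * R := by
    rw [mul_comm]
    gcongr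
  calc _ ≤ 4 * d * R + (2 * d * G * C₀ * R + (d + B') * G * R) := add_le_add h1 (add_le_add h2 h3)
    _ = _ := by ring

end MeanBound

/-! ### Concentration around the mean. -/

section EmpiricalConcentration

variable {Z : Type*} [MeasurableSpace Z] [PseudoMetricSpace Z] [OpensMeasurableSpace Z]
  [SecondCountableTopology Z] [StandardBorelSpace Z]

/-- Moving the sample costs at most the average displacement, by the triangle inequality; since this
is finite, one finite value forces all values to be finite. -/
theorem abs_toReal_W1_empirical_sub_le {P : Measure Z} {n : ℕ} (hn : 1 ≤ n)
    (hfin : ∃ x : Fin n → Z, W1 P (empirical x) ≠ ∞) :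
    (∀ x : Fin n → Z, W1 P (empirical x) ≠ ∞) ∧ ∀ x y : Fin n → Z,
      |(W1 P (empirical x)).toReal - (W1 P (empirical y)).toReal| ≤
        (n : ℝ)⁻¹ * ∑ i, dist (x i) (y i) := by
  have hn0 : (n : ℝ≥0∞) ≠ 0 := by simp; omega
  have hle : ∀ x y : Fin n → Z, W1 P (empirical x) ≤
      W1 P (empirical y) + ENNReal.ofReal ((n : ℝ)⁻¹ * ∑ i, dist (x i) (y i)) := fun x y => by
    have := isProbabilityMeasure_empirical hn y
    refine (W1_triangle P (empirical y) (empirical x)).trans (add_le_add le_rfl ?_)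
    refine (W1_empirical_le y x).trans (le_of_eq ?_)
    rw [ENNReal.ofReal_mul (by positivity), ENNReal.ofReal_inv_of_pos (by positivity),
      ENNReal.ofReal_natCast, ENNReal.ofReal_sum_of_nonneg fun i _ => dist_nonneg]
    simp only [edist_dist, dist_comm]
  have hfin' : ∀ x : Fin n → Z, W1 P (empirical x) ≠ ∞ := fun x => by
    obtain ⟨y, hy⟩ := hfin
    exact ne_top_of_le_ne_top (by finiteness) (hle x y)
  have hreal : ∀ x y : Fin n → Z, (W1 P (empirical x)).toReal - (W1 P (empirical y)).toReal ≤
      (n : ℝ)⁻¹ * ∑ i, dist (x i) (y i) := fun x y => by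
    have h := ENNReal.toReal_mono (by have := hfin' y; finiteness) (hle x y)
    rw [ENNReal.toReal_add (hfin' y) ENNReal.ofReal_ne_top,
      ENNReal.toReal_ofReal (by positivity)] at h
    linarith
  refine ⟨hfin', fun x y => abs_le.2 ⟨?_, hreal x y⟩⟩
  have := hreal y x
  simp only [dist_comm] at this ⊢
  linarith

/-- Concentration of the Wasserstein distance to the empirical measure around its mean. -/
theorem measure_W1_empirical_gt_le {P : Measure Z} [IsProbabilityMeasure P] {K : ℝ} {z₀ : Z}
    (h₀ : Integrable (fun z => Real.exp (dist z z₀)) P)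
    (hcosh : Integrable (fun p : Z × Z => Real.cosh (dist p.1 p.2)) (P.prod P))
    (hK : ∫ p : Z × Z, Real.cosh (dist p.1 p.2) ∂(P.prod P) ≤ K) (hK1 : 1 ≤ K)
    {n : ℕ} (hn : 1 ≤ n) {ε : ℝ} (hε : 0 ≤ ε) (hε1 : ε ≤ 1)
    (hmean : ∫⁻ x, W1 P (empirical x) ∂(Measure.pi fun _ : Fin n => P) ≤
      ENNReal.ofReal (ε / 2)) :
    (Measure.pi fun _ : Fin n => P) {x | ENNReal.ofReal ε < W1 P (empirical x)} ≤
      ENNReal.ofReal (Real.exp (-(n * ε ^ 2 / (16 * K)))) := by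
  set μ := Measure.pi fun _ : Fin n => P with hμ
  have hn0 : (0 : ℝ) < n := by exact_mod_cast hn
  have hfin : ∃ x : Fin n → Z, W1 P (empirical x) ≠ ∞ := by
    by_contra! h
    simp [h] at hmean
  obtain ⟨hfin', hlip⟩ := abs_toReal_W1_empirical_sub_le hn hfin
  set g : (Fin n → Z) → ℝ := fun x => (W1 P (empirical x)).toReal with hg
  have hn1 : (n : ℝ)⁻¹ ≤ 1 := inv_le_one_of_one_le₀ (by exact_mod_cast hn)
  have hgm : Measurable g := (continuous_of_abs_sub_le_sum_dist fun x y =>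
    (hlip x y).trans (mul_le_of_le_one_left (Finset.sum_nonneg fun _ _ => dist_nonneg)
      hn1)).measurable
  have hgi : Integrable g μ := integrable_pi h₀ hn1 hgm hlip
  have hgmean : ∫ x, g x ∂μ ≤ ε / 2 := by
    have h : ENNReal.ofReal (∫ x, g x ∂μ) = ∫⁻ x, W1 P (empirical x) ∂μ := by
      rw [ofReal_integral_eq_lintegral_ofReal hgi (ae_of_all _ fun x => ENNReal.toReal_nonneg)]
      exact lintegral_congr fun x => ENNReal.ofReal_toReal (hfin' x)
    rw [← h] at hmean
    exact (ENNReal.ofReal_le_ofReal_iff (by positivity)).1 hmean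
  -- The minimizer of the Chernoff exponent `-c n ε / 2 + n c² K`, with value `-n ε² / (16 K)`.
  set c : ℝ := ε / (4 * K) with hc
  have hc0 : 0 ≤ c := by positivity
  have hc1 : c ≤ 1 := by
    rw [hc, div_le_one (by positivity)]
    linarith
  have hflip : ∀ x y : Fin n → Z, |c * n * g x - c * n * g y| ≤ c * ∑ i, dist (x i) (y i) :=
    fun x y => by
      rw [← mul_sub, abs_mul, abs_of_nonneg (by positivity : 0 ≤ c * (n : ℝ)), mul_assoc]
      refine mul_le_mul_of_nonneg_left ?_ hc0
      have := mul_le_mul_of_nonneg_left (hlip x y) hn0.le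
      rwa [← mul_assoc, mul_inv_cancel₀ hn0.ne', one_mul] at this
  have hexp := integral_exp_pi_le h₀ hcosh hK hc0 hc1 n (hgm.const_mul (c * n)) hflip
  rw [integral_const_mul] at hexp
  have hmarkov := measure_ge_le_exp_mul_mgf (μ := μ) (X := g) ε
    (by positivity : 0 ≤ c * (n : ℝ)) (integrable_exp_pi h₀ hc1 hflip)
  have hreal : μ.real {x | ε ≤ g x} ≤ Real.exp (-(n * ε ^ 2 / (16 * K))) := by
    refine hmarkov.trans ((mul_le_mul_of_nonneg_left hexp (Real.exp_pos _).le).trans ?_)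
    rw [← Real.exp_add, Real.exp_le_exp]
    have h1 : c * n * ∫ x, g x ∂μ ≤ c * n * (ε / 2) := by gcongr
    have h2 : -(c * n) * ε + (c * n * (ε / 2) + n * (c ^ 2 * K)) = -(n * ε ^ 2 / (16 * K)) := by
      rw [hc]
      field_simp
      ring
    linarith
  calc μ {x | ENNReal.ofReal ε < W1 P (empirical x)} ≤ μ {x | ε ≤ g x} := by
        refine measure_mono fun x hx => ?_
        exact (ENNReal.ofReal_le_iff_le_toReal (hfin' x)).1 (le_of_lt hx)
    _ = ENNReal.ofReal (μ.real {x | ε ≤ g x}) := (ofReal_measureReal).symm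
    _ ≤ _ := ENNReal.ofReal_le_ofReal hreal

end EmpiricalConcentration

/-! ### Uniform tail bound in normed spaces. -/

section NormedSpace

variable {E : Type*} [NormedAddCommGroup E] [MeasurableSpace E] [BorelSpace E] {Z : Set E}
  {P : Measure Z} [IsProbabilityMeasure P]

omit [IsProbabilityMeasure P] in
theorem integrable_exp_norm_of_lintegral_le {B : ℝ} (hB0 : 0 ≤ B)
    (hB : ∫⁻ z : Z, ENNReal.ofReal (Real.exp ‖(z : E)‖) ∂P ≤ ENNReal.ofReal B) :
    Integrable (fun z : Z => Real.exp ‖(z : E)‖) P ∧ ∫ z : Z, Real.exp ‖(z : E)‖ ∂P ≤ B := by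
  have hm : Measurable fun z : Z => Real.exp ‖(z : E)‖ :=
    Real.measurable_exp.comp (measurable_norm.comp measurable_subtype_coe)
  have hi : Integrable (fun z : Z => Real.exp ‖(z : E)‖) P := by
    refine ⟨hm.aestronglyMeasurable, ?_⟩
    rw [hasFiniteIntegral_iff_ofReal (ae_of_all _ fun z => (Real.exp_pos _).le)]
    exact hB.trans_lt ENNReal.ofReal_lt_top
  refine ⟨hi, ?_⟩
  rw [← ofReal_integral_eq_lintegral_ofReal hi (ae_of_all _ fun z => (Real.exp_pos _).le)] at hB
  exact (ENNReal.ofReal_le_ofReal_iff hB0).1 hB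

omit [IsProbabilityMeasure P] in
theorem integrable_exp_dist (h : Integrable (fun z : Z => Real.exp ‖(z : E)‖) P) (z₀ : Z) :
    Integrable (fun z : Z => Real.exp (dist z z₀)) P := by
  refine (h.mul_const (Real.exp ‖(z₀ : E)‖)).mono' ?_ (ae_of_all _ fun z => ?_)
  · exact (Real.continuous_exp.comp (continuous_id.dist continuous_const)).measurable.aestronglyMeasurable
  · rw [Real.norm_eq_abs, abs_of_pos (Real.exp_pos _), ← Real.exp_add, Real.exp_le_exp,
      Subtype.dist_eq, dist_eq_norm]
    exact norm_sub_le _ _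

/-- The bound `cosh (dist x y) ≤ exp ‖x‖ * exp ‖y‖` factorizes under the product measure, so the
concentration constant depends only on the exponential moment. -/
theorem integrable_cosh_dist [SecondCountableTopology E]
    (h : Integrable (fun z : Z => Real.exp ‖(z : E)‖) P) :
    Integrable (fun p : Z × Z => Real.cosh (dist p.1 p.2)) (P.prod P) ∧
      ∫ p : Z × Z, Real.cosh (dist p.1 p.2) ∂(P.prod P) ≤
        (∫ z : Z, Real.exp ‖(z : E)‖ ∂P) ^ 2 := by
  have hle : ∀ p : Z × Z, Real.cosh (dist p.1 p.2) ≤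
      Real.exp ‖(p.1 : E)‖ * Real.exp ‖(p.2 : E)‖ := fun p => by
    have h1 : dist p.1 p.2 ≤ ‖(p.1 : E)‖ + ‖(p.2 : E)‖ := by
      rw [Subtype.dist_eq, dist_eq_norm]
      exact norm_sub_le _ _
    have h2 : Real.exp (-dist p.1 p.2) ≤ Real.exp (dist p.1 p.2) :=
      Real.exp_le_exp.2 (by have := dist_nonneg (x := p.1) (y := p.2); linarith)
    rw [← Real.exp_add]
    refine le_trans ?_ (Real.exp_le_exp.2 h1)
    rw [Real.cosh_eq]
    linarith
  have hb := h.mul_prod h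
  have hi : Integrable (fun p : Z × Z => Real.cosh (dist p.1 p.2)) (P.prod P) := by
    refine hb.mono' ?_ (ae_of_all _ fun p => ?_)
    · exact (Real.continuous_cosh.measurable.comp measurable_dist).aestronglyMeasurable
    · rw [Real.norm_eq_abs, abs_of_pos (Real.cosh_pos _)]
      exact hle p
  refine ⟨hi, (integral_mono hi hb hle).trans (le_of_eq ?_)⟩
  rw [integral_prod_mul (fun z : Z => Real.exp ‖(z : E)‖) fun z : Z => Real.exp ‖(z : E)‖, sq]

theorem integrable_of_lipschitzWith (h : Integrable (fun z : Z => Real.exp ‖(z : E)‖) P)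
    {g : Z → ℝ} {K : ℝ≥0} (hg : LipschitzWith K g) : Integrable g P := by
  obtain ⟨z₀⟩ : Nonempty Z := P.nonempty_of_neZero
  refine ((integrable_const |g z₀|).add ((integrable_exp_dist h z₀).const_mul K)).mono'
    hg.continuous.measurable.aestronglyMeasurable (ae_of_all _ fun z => ?_)
  have h1 := hg.dist_le_mul z z₀
  rw [Real.dist_eq] at h1
  have h2 : dist z z₀ ≤ Real.exp (dist z z₀) := by
    have := Real.add_one_le_exp (dist z z₀); linarith
  have h3 : (K : ℝ) * dist z z₀ ≤ K * Real.exp (dist z z₀) := by gcongr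
  have h4 := abs_sub_abs_le_abs_sub (g z) (g z₀)
  simp only [Pi.add_apply, Real.norm_eq_abs]
  linarith

/-- Concentration of the empirical measure in the Wasserstein distance, with constants depending
only on the dimension and an exponential moment. -/
theorem exists_measure_W1_empirical_gt_le {d : ℕ} (hd : d ≠ 2) (B : ℝ) :
    ∃ c₁ c₂ : ℝ, 1 < c₁ ∧ 0 < c₂ ∧
      ∀ (E : Type*) [NormedAddCommGroup E] [NormedSpace ℝ E] [FiniteDimensional ℝ E]
        [MeasurableSpace E] [BorelSpace E], Module.finrank ℝ E = d →
      ∀ (Z : Set E), MeasurableSet Z → ∀ (P : Measure Z) [IsProbabilityMeasure P],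
        ∫⁻ z : Z, ENNReal.ofReal (Real.exp ‖(z : E)‖) ∂P ≤ ENNReal.ofReal B →
      ∀ n : ℕ, 1 ≤ n → ∀ ε : ℝ, 0 ≤ ε → ε ≤ 1 →
        (Measure.pi fun _ : Fin n => P) {x | ENNReal.ofReal ε < W1 P (empirical x)} ≤
          ENNReal.ofReal (c₁ * Real.exp (-(c₂ * n * ε ^ max d 2))) := by
  obtain ⟨C, hC, hmean⟩ := exists_lintegral_W1_empirical_le hd B
  set D := max d 2 with hD
  have hD2 : 2 ≤ D := le_max_right _ _
  set K : ℝ := max B 1 ^ 2 with hK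
  have hK1 : 1 ≤ K := one_le_pow₀ (le_max_right _ _)
  set c₂ : ℝ := 1 / (16 * K) with hc₂
  have hc₂0 : 0 < c₂ := by positivity
  -- The exponential makes the bound at least one whenever `ε` is below twice the mean bound; the
  -- factor two gives `1 < c₁`.
  refine ⟨2 * Real.exp (c₂ * (2 * C) ^ D), c₂, ?_, hc₂0, ?_⟩
  · have : 1 ≤ Real.exp (c₂ * (2 * C) ^ D) := Real.one_le_exp (by positivity)
    linarith
  intro E _ _ _ _ _ hE Z hZ P _ hB n hn ε hε hε1
  have : ProperSpace E := FiniteDimensional.proper ℝ E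
  have : StandardBorelSpace Z := hZ.standardBorel
  have hn0 : (0 : ℝ) < n := by exact_mod_cast hn
  by_cases hcase : C * (n : ℝ) ^ (-((1 : ℝ) / D)) ≤ ε / 2
  -- Here the mean is at most `ε / 2` and concentration applies; `ε ≤ 1` weakens `ε ^ 2` to `ε ^ D`.
  · obtain ⟨hi, hle⟩ := integrable_exp_norm_of_lintegral_le (B := max B 1) (by positivity)
      (hB.trans (ENNReal.ofReal_le_ofReal (le_max_left _ _)))
    obtain ⟨hci, hcle⟩ := integrable_cosh_dist hi
    obtain ⟨z₀⟩ : Nonempty Z := P.nonempty_of_neZero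
    have h0 : 0 ≤ ∫ z : Z, Real.exp ‖(z : E)‖ ∂P := integral_nonneg fun z => (Real.exp_pos _).le
    refine (measure_W1_empirical_gt_le (integrable_exp_dist hi z₀) hci
      (hcle.trans (pow_le_pow_left₀ h0 hle 2)) hK1 hn hε hε1
      ((hmean E hE Z hZ P hB n hn).trans (ENNReal.ofReal_le_ofReal hcase))).trans
      (ENNReal.ofReal_le_ofReal ?_)
    have h1 : Real.exp (-(n * ε ^ 2 / (16 * K))) ≤ Real.exp (-(c₂ * n * ε ^ D)) := by
      rw [Real.exp_le_exp, neg_le_neg_iff]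
      have : ε ^ D ≤ ε ^ 2 := pow_le_pow_of_le_one hε hε1 hD2
      calc c₂ * n * ε ^ D ≤ c₂ * n * ε ^ 2 := by gcongr
        _ = n * ε ^ 2 / (16 * K) := by rw [hc₂]; ring
    have h2 : 1 ≤ 2 * Real.exp (c₂ * (2 * C) ^ D) := by
      have : 1 ≤ Real.exp (c₂ * (2 * C) ^ D) := Real.one_le_exp (by positivity)
      linarith
    exact h1.trans (le_mul_of_one_le_left (Real.exp_pos _).le h2)
  · push Not at hcase
    refine prob_le_one.trans ?_
    rw [← ENNReal.ofReal_one]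
    refine ENNReal.ofReal_le_ofReal ?_
    have h1 : n * ε ^ D ≤ (2 * C) ^ D := by
      have h2 : ε ≤ 2 * C * (n : ℝ) ^ (-((1 : ℝ) / D)) := by linarith
      have h3 : ((n : ℝ) ^ (-((1 : ℝ) / D))) ^ D = (n : ℝ)⁻¹ := by
        rw [Real.rpow_neg hn0.le, inv_pow, one_div, Real.rpow_inv_natCast_pow hn0.le (by omega)]
      calc n * ε ^ D ≤ n * (2 * C * (n : ℝ) ^ (-((1 : ℝ) / D))) ^ D := by gcongr
        _ = (2 * C) ^ D := by rw [mul_pow, h3]; field_simp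
    rw [mul_assoc, ← Real.exp_add]
    have h4 : 0 ≤ c₂ * (2 * C) ^ D + -(c₂ * n * ε ^ D) := by
      have := mul_le_mul_of_nonneg_left h1 hc₂0.le
      linarith
    have := Real.one_le_exp h4
    linarith

omit [BorelSpace E] [IsProbabilityMeasure P] in
-- For `t ≥ 0` and `a > 1`, `t ≤ 1 + t ^ a`: the assumed moment enters only through this simple
-- exponential moment.
theorem lintegral_exp_norm_le {a A : ℝ} (ha : 1 < a)
    (hi : Integrable (fun z : Z => Real.exp (‖(z : E)‖ ^ a)) P)
    (hA : ∫ z : Z, Real.exp (‖(z : E)‖ ^ a) ∂P = A) :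
    ∫⁻ z : Z, ENNReal.ofReal (Real.exp ‖(z : E)‖) ∂P ≤ ENNReal.ofReal (Real.exp 1 * A) := by
  rw [← hA, ← integral_const_mul, ofReal_integral_eq_lintegral_ofReal (hi.const_mul _)
    (ae_of_all _ fun z => by positivity)]
  refine lintegral_mono fun z => ENNReal.ofReal_le_ofReal ?_
  rw [← Real.exp_add, Real.exp_le_exp]
  rcases le_total ‖(z : E)‖ 1 with h | h
  · have : 0 ≤ ‖(z : E)‖ ^ a := by positivity
    linarith
  · have := Real.self_le_rpow_of_one_le h ha.le
    linarith

end NormedSpace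

end WDRO

/-! ### The main theorem. -/

theorem theorem9 (d : ℕ) (hd : d ≠ 2) (a A : ℝ) (ha : 1 < a) :
    ∃ c₁ c₂ : ℝ, 1 < c₁ ∧ 0 < c₂ ∧
      -- the space `ℝ ^ d` with a given norm, and a sample space in it
      ∀ (E : Type*) [NormedAddCommGroup E] [NormedSpace ℝ E] [FiniteDimensional ℝ E]
        [MeasurableSpace E] [BorelSpace E], Module.finrank ℝ E = d →
      ∀ (Z : Set E), MeasurableSet Z →
      -- the training and the test distribution
      ∀ (Ptrain Ptest : Measure Z) [IsProbabilityMeasure Ptrain] [IsProbabilityMeasure Ptest],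
        Integrable (fun z : Z => Real.exp (‖(z : E)‖ ^ a)) Ptrain →
        ∫ z : Z, Real.exp (‖(z : E)‖ ^ a) ∂Ptrain = A →
        WDRO.W1 Ptrain Ptest < ∞ →
      -- the function class, the loss and an oracle best solution for the test distribution
      ∀ (F : Type*) (ℓ : F → Z → ℝ), (∀ f, Measurable (ℓ f)) →
      ∀ fstar : F, WDRO.IsOracle ℓ Ptest fstar →
      -- confidence level and sample size
      ∀ (δ : ℝ) (n : ℕ), 0 < δ → 1 ≤ n → Real.log (c₁ / δ) / c₂ ≤ n →
      -- the iid training sample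
      ∀ (Ω : Type*) [MeasurableSpace Ω] (μ : Measure Ω) [IsProbabilityMeasure μ]
        (z : Fin n → Ω → Z), (∀ i, Measurable (z i)) → iIndepFun z μ →
        (∀ i, μ.map (z i) = Ptrain) →
      -- the data-driven DRO solution
      ∀ fdro : Ω → F,
        (∀ᵐ ω ∂μ, WDRO.IsDROSolution ℓ (WDRO.empirical fun i => z i ω)
          (WDRO.radius Ptrain Ptest c₁ c₂ δ n d) (fdro ω)) →
        μ {ω | ¬ (WDRO.expect Ptest (ℓ (fdro ω)) - WDRO.expect Ptest (ℓ fstar) ≤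
          ((2 * WDRO.lipNorm (ℓ fstar) *
            ENNReal.ofReal (WDRO.radius Ptrain Ptest c₁ c₂ δ n d) : ℝ≥0∞) : EReal))}
          ≤ ENNReal.ofReal δ := by
  obtain ⟨c₁, c₂, hc₁, hc₂, hconc⟩ :=
    WDRO.exists_measure_W1_empirical_gt_le hd (Real.exp 1 * A)
  refine ⟨c₁, c₂, hc₁, hc₂, ?_⟩
  intro E _ _ _ _ _ hE Z hZ Ptrain Ptest _ _ hi hA hW F ℓ _ fstar _ δ n hδ hn hnδ Ω _ μ _ z hz
    hind hlaw fdro hdro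
  have : ProperSpace E := FiniteDimensional.proper ℝ E
  have : StandardBorelSpace Z := hZ.standardBorel
  have hn0 : (0 : ℝ) < n := by exact_mod_cast hn
  rcases le_or_gt 1 δ with hδ1 | hδ1
  · exact prob_le_one.trans (by simpa using ENNReal.ofReal_le_ofReal hδ1)
  have hlog : 0 < Real.log (c₁ / δ) := Real.log_pos (by rw [one_lt_div hδ]; linarith)
  have hB := WDRO.lintegral_exp_norm_le ha hi hA
  have hD0 : max d 2 ≠ 0 := by omega
  set ε : ℝ := (Real.log (c₁ / δ) / (c₂ * n)) ^ ((1 : ℝ) / (max d 2 : ℕ)) with hε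
  have hratio : 0 < Real.log (c₁ / δ) / (c₂ * n) := by positivity
  -- The sample size condition says exactly that `ε ≤ 1`, the range of the tail bound.
  have hratio1 : Real.log (c₁ / δ) / (c₂ * n) ≤ 1 := by
    rw [div_le_iff₀ hc₂] at hnδ
    rw [div_le_one (by positivity)]
    linarith
  have hε0 : 0 < ε := Real.rpow_pos_of_pos hratio _
  have hε1 : ε ≤ 1 := Real.rpow_le_one hratio.le hratio1 (by positivity)
  have hεpow : c₁ * Real.exp (-(c₂ * n * ε ^ max d 2)) = δ := by
    rw [hε, one_div, Real.rpow_inv_natCast_pow hratio.le hD0,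
      mul_div_cancel₀ _ (by positivity), Real.exp_neg, Real.exp_log (by positivity)]
    field_simp
  have hconc' := hconc E hE Z hZ Ptrain hB n hn ε hε0.le hε1
  rw [hεpow] at hconc'
  set η := WDRO.radius Ptrain Ptest c₁ c₂ δ n d with hη
  have hηeq : η = (WDRO.W1 Ptrain Ptest).toReal + ε := rfl
  have hη0 : 0 < η := by rw [hηeq]; positivity
  obtain ⟨hei, -⟩ := WDRO.integrable_exp_norm_of_lintegral_le (B := max (Real.exp 1 * A) 0)
    (le_max_right _ _) (hB.trans (ENNReal.ofReal_le_ofReal (le_max_left _ _)))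
  -- Lipschitz functions are integrable under the training law by its exponential moment, and under
  -- the test law because the transport distance is finite.
  have hlip : ∀ (g : Z → ℝ) (K : ℝ≥0), LipschitzWith K g → Integrable g Ptest := fun g K hg =>
    (WDRO.integral_sub_le_W1 hg (WDRO.integrable_of_lipschitzWith hei hg)
      (by rw [WDRO.W1_comm]; exact hW.ne)).1
  have hjoint : μ.map (fun ω i => z i ω) = Measure.pi fun _ : Fin n => Ptrain := by
    rw [(iIndepFun_iff_map_fun_eq_pi_map fun i => (hz i).aemeasurable).1 hind]
    simp only [hlaw]
  have hzm : Measurable fun ω i => z i ω := measurable_pi_iff.2 hz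
  calc μ {ω | ¬ (WDRO.expect Ptest (ℓ (fdro ω)) - WDRO.expect Ptest (ℓ fstar) ≤
          ((2 * WDRO.lipNorm (ℓ fstar) * ENNReal.ofReal η : ℝ≥0∞) : EReal))}
      ≤ μ ((fun ω i => z i ω) ⁻¹'
          {x | ENNReal.ofReal ε < WDRO.W1 Ptrain (WDRO.empirical x)}) := by
        refine measure_mono_ae ?_
        filter_upwards [hdro] with ω hω hbad
        by_contra hgood
        refine hbad ?_
        have hle : WDRO.W1 Ptrain (WDRO.empirical fun i => z i ω) ≤ ENNReal.ofReal ε :=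
          not_lt.1 hgood
        have := WDRO.isProbabilityMeasure_empirical hn fun i => z i ω
        refine WDRO.expect_sub_le_of_isDROSolution hη0 ?_ hlip fstar hω
        refine (WDRO.W1_triangle _ Ptrain _).trans ?_
        rw [hηeq, ENNReal.ofReal_add ENNReal.toReal_nonneg hε0.le, ENNReal.ofReal_toReal hW.ne,
          add_comm, WDRO.W1_comm (WDRO.empirical fun i => z i ω)]
        exact add_le_add le_rfl hle
    -- This direction of the image-measure inequality holds for every set, so the event need not be
    -- shown measurable.
    _ ≤ μ.map (fun ω i => z i ω) {x | ENNReal.ofReal ε < WDRO.W1 Ptrain (WDRO.empirical x)} :=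
        Measure.le_map_apply hzm.aemeasurable _
    _ ≤ ENNReal.ofReal δ := by rw [hjoint]; exact hconc'
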